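/- **Setting.** Fix a linearly ordered set $\mathbb T$ of finite times, a countably infinite set $L$ of channel names, and a set $V$ of variables with decidable equality. All unions of multisets are written $\uplus$. *Types* are $A ::= 1^{t.p}\mid A_1\multimap^{t.p}A_2\mid A_1\otimes^{t.p}A_2\mid A_1\mathbin{\&}^{t.p}A_2\mid A_1\oplus^{t.p}A_2$, where $p$ is a proposition about the time $t$, and $t$ is bound in $p$, $A_1$, $A_2$. *Processes.* Let $s$ range over channels and variables, $e$ over the selectors $\pi_1,\pi_2$, and $T$ over finite times. $$\begin{aligned}M ::={}& \mathsf{fwd}^T(\leftarrow s)\mid \mathsf{let}^T\,x{:}A\leftarrow M_1;M_2\mid \mathsf{send}^{t.p}()\mid \mathsf{recv}^T_s();M\mid \mathsf{recv}^{t.p}(x\Rightarrow M)\mid \mathsf{send}^T_s(M_1);M_2\mid \mathsf{send}^{t.p}(M_1);M_2\mid \mathsf{recv}^T_s(y\Rightarrow M)\\ &\mid \mathsf{recv}^{t.p}(\pi_1\Rightarrow M_1\mid\pi_2\Rightarrow M_2)\mid \mathsf{send}^T_s(e);M\mid \mathsf{send}^{t.p}(e);M\mid \mathsf{recv}^T_s(\pi_1\Rightarrow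 M_1\mid\pi_2\Rightarrow M_2),\end{aligned}$$ where in the forms annotated by $t.p$ the variable $t$ is bound in $p$ and in the continuations. Substitution $M[b/x]$ of a channel $b$ for a variable $x$ replaces the free occurrences of $x$. *Retyping.* $A\rtimes B\ @\ T$ relates types with the same connective, annotated $t.p$ and $t.q$ respectively, such that for every $t$ with $q(t)$: $p(t)$, $T\le t$, and the components are related at $t$ by $A_i\rtimes B_i\ @\ t$ (for $\multimap$: $B_1\rtimes A_1$ and $A_2\rtimes B_2$). $A\ltimes B\ @\ T$ is defined in the same way with $\ltimes$, except that for every $t$ with $T\le t$ and $q(t)$ one asks for $p(t)$ and the components being related at $t$. *Typing* $\Gamma\vdash M\ @\ T::A$, where $\Gamma$ is a finite map from variables to types, unions $\Gamma_1,\Gamma_2$ are disjoint and extensions $\Gamma,x{:}A$ use $x\notin\Gamma$. It is generated by the following rules. "For $t.p$" means: for all $t$ with $p(t)$. Every rule with a conclusion annotated $t.p$ on the right also requires $T\le t$ for $t.p$, and every rule that acts at time $T'$ on a variable $x$ whose type is annotated $t.p$ also requires $T\le T'$ and $p(T')$. - Cut: from $\Gamma_1\vdash M_1@T::A$, $\Gamma_2,x{:}A'\vdash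 M_2@T::C$ and $A\ltimes A'@T$, infer $\Gamma_1,\Gamma_2\vdash(\mathsf{let}^T x{:}A'\leftarrow M_1;M_2)@T::C$. - Fwd: from $A\rtimes A'@T$, infer $x{:}A\vdash\mathsf{fwd}^T(\leftarrow x)@T::A'$. - $1$: $\varnothing\vdash\mathsf{send}^{t.p}()@T::1^{t.p}$; and from $\Gamma\vdash M@T'::C$, infer $\Gamma,x{:}1^{t.p}\vdash(\mathsf{recv}^{T'}_x();M)@T::C$. - $\multimap$: from $\Gamma,x{:}A_1\vdash M@t::A_2$ for $t.p$, infer $\Gamma\vdash\mathsf{recv}^{t.p}(x\Rightarrow M)@T::A_1\multimap^{t.p}A_2$; and from $\Gamma_1\vdash M_1@T'::A_1[T'/t]$ and $\Gamma_2,x{:}A_2[T'/t]\vdash M_2@T'::C$, infer $\Gamma_1,\Gamma_2,x{:}A_1\multimap^{t.p}A_2\vdash(\mathsf{send}^{T'}_x(M_1);M_2)@T::C$. - $\otimes$: from $\Gamma_i\vdash M_i@t::A_i$ for $t.p$ ($i=1,2$), infer $\Gamma_1,\Gamma_2\vdash(\mathsf{send}^{t.p}(M_1);M_2)@T::A_1\otimes^{t.p}A_2$;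 and from $\Gamma,x{:}A_2[T'/t],y{:}A_1[T'/t]\vdash M@T'::C$, infer $\Gamma,x{:}A_1\otimes^{t.p}A_2\vdash\mathsf{recv}^{T'}_x(y\Rightarrow M)@T::C$. - $\&$: from $\Gamma\vdash M_i@t::A_i$ for $t.p$ ($i=1,2$), infer $\Gamma\vdash\mathsf{recv}^{t.p}(\pi_1\Rightarrow M_1\mid\pi_2\Rightarrow M_2)@T::A_1\mathbin\&^{t.p}A_2$; and from $\Gamma,x{:}A_i[T'/t]\vdash M@T'::C$, infer $\Gamma,x{:}A_1\mathbin\&^{t.p}A_2\vdash(\mathsf{send}^{T'}_x(\pi_i);M)@T::C$. - $\oplus$: from $\Gamma\vdash M@t::A_i$ for $t.p$, infer $\Gamma\vdash(\mathsf{send}^{t.p}(\pi_i);M)@T::A_1\oplus^{t.p}A_2$; and from $\Gamma,x{:}A_i[T'/t]\vdash M_i@T'::C$ ($i=1,2$), infer $\Gamma,x{:}A_1\oplus^{t.p}A_2\vdash\mathsf{recv}^{T'}_x(\pi_1\Rightarrow M_1\mid\pi_2\Rightarrow M_2)@T::C$. *Transitions.* An action is $\varepsilon$ or $a!c$ or $a?c$,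 with a payload $c$ that is a selector, the closing signal $()$, or a channel. A *language* is a set of nameless objects with a relation $(P,a)\xrightarrow{\alpha}_T\Omega$, where $\Omega$ is a finite multiset of atomic objects, which have the form $\mathsf{proc}(a,P)$ or $\mathsf{fwd}(a,b)$. The processes form a language, with provider channel $a$: - at the annotated time $T$: $\mathsf{fwd}^T(\leftarrow b)\xrightarrow{\varepsilon}\{\mathsf{fwd}(a,b)\}$; $\ \mathsf{let}^T x{:}A\leftarrow M_1;M_2\xrightarrow{\varepsilon}\{\mathsf{proc}(b',M_1),\mathsf{proc}(a,M_2[b'/x])\}$ for any $b'$; $\ \mathsf{recv}^T_b();M\xrightarrow{b?()}\{\mathsf{proc}(a,M)\}$; $\ \mathsf{recv}^T_b(y\Rightarrow M)\xrightarrow{b?c}\{\mathsf{proc}(a,M[c/y])\}$; $\ \mathsf{send}^T_b(M_1);M_2\xrightarrow{b!c}\{\mathsf{proc}(c,M_1),\mathsf{proc}(a,M_2)\}$; $\ \mathsf{recv}^T_b(\pi_1\Rightarrow M_1\mid\pi_2\Rightarrow M_2)\xrightarrow{b?\pi_i}\{\mathsf{proc}(a,M_i)\}$; $\ \mathsf{send}^T_b(\pi_i);M\xrightarrow{b!\pi_i}\{\mathsf{proc}(a,M)\}$;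 - at any time $T$ with $p(T)$, the continuations being taken at $t=T$: $\mathsf{send}^{t.p}()\xrightarrow{a!()}\varnothing$; $\ \mathsf{send}^{t.p}(M_1);M_2\xrightarrow{a!c}\{\mathsf{proc}(a,M_2),\mathsf{proc}(c,M_1)\}$; $\ \mathsf{recv}^{t.p}(x\Rightarrow M)\xrightarrow{a?b}\{\mathsf{proc}(a,M[b/x])\}$; $\ \mathsf{send}^{t.p}(\pi_i);M\xrightarrow{a!\pi_i}\{\mathsf{proc}(a,M)\}$; $\ \mathsf{recv}^{t.p}(\pi_1\Rightarrow M_1\mid\pi_2\Rightarrow M_2)\xrightarrow{a?\pi_i}\{\mathsf{proc}(a,M_i)\}$. A *configuration* is a finite multiset of atomic objects over all languages. Its transitions $\Omega\xrightarrow{\alpha}_T\Omega'$ are generated by: the transitions of the languages; $\Omega\uplus\Omega_0\xrightarrow{\alpha}_T\Omega'\uplus\Omega_0$ if $\Omega\xrightarrow{\alpha}_T\Omega'$; $\{\mathsf{proc}(a,P),\mathsf{fwd}(b,a)\}\xrightarrow{\varepsilon}_T\{\mathsf{proc}(b,P)\}$; and $\Omega_1\uplus\Omega_2\xrightarrow{\varepsilon}_T\Omega_1'\uplus\Omega_2'$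 if $\Omega_1\xrightarrow{a!c}_T\Omega_1'$ and $\Omega_2\xrightarrow{a?c}_T\Omega_2'$. A *nameless configuration* is a pair $(\Omega,P)$ of a configuration and a nameless object, and $(\Omega,P)[a]=\Omega\uplus\{\mathsf{proc}(a,P)\}$. *Computable trajectories.* A *multistepping* from $(\Omega,T)$ to $(\Omega',T')$ is a finite sequence of passages of time $(\Omega,T_1)\to(\Omega,T_2)$, $T_1\le T_2$, and instantaneous silent steps $(\Omega,T)\to(\Omega',T)$ with $\Omega\xrightarrow{\varepsilon}_T\Omega'$. It *realizes* a function $s$ from $[T,T'')$ to configurations as follows: the empty multistepping realizes the constant function if $T<T''$; if $\sigma$ from $(\Omega,T_2)$ realizes $s$ and $T\le T_2$, then $\sigma$ preceded by the passage of time from $T$ to $T_2$ realizes $s$ extended by the value $\Omega$ on $[T,T_2)$; and if $\sigma$ realizes $s$, so does $\sigma$ preceded by a silent step. A *computable trajectory* $w:\mathcal S[T_1,T_2)$ consists of two nameless configurations (its start and its end), a function $t\mapsto w[t]$ from $[T_1,T_2)$ to nameless configurations, and, for every channel $a$, a finite time $T_a$ and a multistepping from $(\mathrm{start}(w)[a],T_1)$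 to $(\mathrm{end}(w)[a],T_a)$ that realizes $t\mapsto w[t][a]$. **Corollary (Adequacy).** Let $P$ be a process, $p$ a temporal predicate, $a$ a channel name, and $T\le T'$ finite times. If $\varnothing\vdash P\ @\ T::1^{t.p}$ and $p(T')$ holds, then there is a computable trajectory $w:\mathcal S[T,\infty)$ with $$\mathrm{start}(w)=(\varnothing,P)\qquad\text{and}\qquad w[T'][a]\xrightarrow{\ a!()\ }_{T'}\varnothing .$$ -/

import Mathlib

namespace TimedSession

universe u

/-! ## Payloads, actions, atomic objects

`τ` is the set of finite times (a linear order), `L` the set of channel names, `V` the set of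
variables.  The extended times are `WithTop τ`. -/

/-- The two selectors `π₁`, `π₂`. -/
inductive Sel : Type
  | pi1
  | pi2

/-- The component of a pair that is named by a selector. -/
def Sel.pick {α : Type*} : Sel → α → α → α
  | .pi1, x, _ => x
  | .pi2, _, y => y

/-- Payloads: a selector, the closing signal, or a channel name. -/
inductive Payload (L : Type) : Type
  | sel (e : Sel)
  | close
  | chan (a : L)

/-- Directions: sending `!` and receiving `?`. -/
inductive Dir : Type
  | send
  | recv

/-- Actions: the silent action `ε`, or a triple of a channel, a direction and a payload. -/
inductive Action (L : Type) : Type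
  | eps
  | comm (a : L) (d : Dir) (c : Payload L)

/-- Atomic objects over a set `X` of nameless objects: `proc a P` is `P` with providing channel
`a`, and `fwd a b` provides `a` by forwarding to `b`. -/
inductive Atomic (L : Type) (X : Type*) : Type _
  | proc (a : L) (P : X)
  | fwd (a b : L)

/-- Functorial action on the nameless objects. -/
def Atomic.map {L : Type} {X Y : Type*} (f : X → Y) : Atomic L X → Atomic L Y
  | .proc a P => .proc a (f P)
  | .fwd a b => .fwd a b

/-! ## Languages and configurations -/

/-- A language of nameless objects with its transition relation. -/
structure ProcLang (τ : Type u) (L : Type) : Type (u + 1) where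
  NObj : Type u
  step : NObj → L → Action L → τ → Multiset (Atomic L NObj) → Prop

/-- Heterogeneous nameless objects: an object together with its language. -/
abbrev NObj (τ : Type u) (L : Type) : Type (u + 1) := Σ S : ProcLang τ L, S.NObj

/-- Configurations: finite multisets of atomic objects. -/
abbrev Cfg (τ : Type u) (L : Type) : Type (u + 1) := Multiset (Atomic L (NObj τ L))

/-- Nameless configurations: a configuration with a distinguished nameless root object. -/
abbrev NCfg (τ : Type u) (L : Type) : Type (u + 1) := Cfg τ L × NObj τ L

/-- Instantiation `Ω[a]` of a nameless configuration at a channel `a`. -/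
def NCfg.inst {τ : Type u} {L : Type} (Ω : NCfg τ L) (a : L) : Cfg τ L :=
  Ω.1 + {Atomic.proc a Ω.2}

/-- Labelled transitions between configurations at a given time. -/
inductive Step {τ : Type u} {L : Type} : Cfg τ L → Action L → τ → Cfg τ L → Prop
  | obj (S : ProcLang τ L) (P : S.NObj) (a : L) (α : Action L) (T : τ)
      (Ω' : Multiset (Atomic L S.NObj)) :
      S.step P a α T Ω' →
      Step {Atomic.proc a ⟨S, P⟩} α T (Ω'.map (Atomic.map (fun x => ⟨S, x⟩)))
  | frame (Ω Ω' Ω₀ : Cfg τ L) (α : Action L) (T : τ) :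
      Step Ω α T Ω' → Step (Ω + Ω₀) α T (Ω' + Ω₀)
  | fwd (a b : L) (P : NObj τ L) (T : τ) :
      Step {Atomic.proc a P, Atomic.fwd b a} Action.eps T {Atomic.proc b P}
  | comm (Ω₁ Ω₁' Ω₂ Ω₂' : Cfg τ L) (a : L) (c : Payload L) (T : τ) :
      Step Ω₁ (Action.comm a Dir.send c) T Ω₁' →
      Step Ω₂ (Action.comm a Dir.recv c) T Ω₂' →
      Step (Ω₁ + Ω₂) Action.eps T (Ω₁' + Ω₂')

/-- Multisteppings from a configuration at a time to a configuration at a time. -/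
inductive MultiStep {τ : Type u} [LinearOrder τ] {L : Type} :
    Cfg τ L → τ → Cfg τ L → τ → Type (u + 1)
  | refl (Ω : Cfg τ L) (T : τ) : MultiStep Ω T Ω T
  | stepT {Ω Ω' : Cfg τ L} {T₁ T₂ T₃ : τ} (h : T₁ ≤ T₂) (σ : MultiStep Ω T₂ Ω' T₃) :
      MultiStep Ω T₁ Ω' T₃
  | stepC {Ω Ω' Ω'' : Cfg τ L} {T₁ T₂ : τ} (s : Step Ω Action.eps T₁ Ω')
      (σ : MultiStep Ω' T₁ Ω'' T₂) : MultiStep Ω T₁ Ω'' T₂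

/-! ## Trajectories -/

/-- Functions on the interval `[T, T')` with values in `X`.  A time below `T'` is finite, so the
argument ranges over the finite times. -/
def Traj {τ : Type u} [LinearOrder τ] (X : Type*) (T : τ) (T' : WithTop τ) : Type _ :=
  (T₀ : τ) → T ≤ T₀ → (T₀ : WithTop τ) < T' → X

namespace Traj

variable {τ : Type u} [LinearOrder τ] {X Y : Type*}

/-- The constant trajectory. -/
def const (x : X) (T : τ) (T' : WithTop τ) : Traj X T T' := fun _ _ _ => x

/-- Concatenation of a trajectory on `[T₁, T₂)` and one on `[T₂, T₃)`. -/
def concat {T₁ T₂ : τ} {T₃ : WithTop τ} (s₁ : Traj X T₁ (T₂ : WithTop τ)) (s₂ : Traj X T₂ T₃) :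
    Traj X T₁ T₃ := fun T₀ h₁ h₃ =>
  if h : T₀ < T₂ then s₁ T₀ h₁ (WithTop.coe_lt_coe.mpr h) else s₂ T₀ (not_lt.mp h) h₃

/-- Extension of `s` to the earlier starting time `T₃` by the constant `x`. -/
def extend (x : X) (T₃ : τ) {T₁ : τ} {T₂ : WithTop τ} (s : Traj X T₁ T₂) : Traj X T₃ T₂ :=
  concat (const x T₃ (T₁ : WithTop τ)) s

/-- Pointwise application of a function to a trajectory. -/
def map (f : X → Y) {T : τ} {T' : WithTop τ} (s : Traj X T T') : Traj Y T T' :=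
  fun T₀ h h' => f (s T₀ h h')

end Traj

/-- `Realizes s σ`: the trajectory `s` is realized by the multistepping `σ`. -/
inductive Realizes {τ : Type u} [LinearOrder τ] {L : Type} {T' : WithTop τ} :
    {T : τ} → {Ω Ω' : Cfg τ L} → {T'' : τ} →
      Traj (Cfg τ L) T T' → MultiStep Ω T Ω' T'' → Prop
  | refl (Ω : Cfg τ L) (T : τ) (h : (T : WithTop τ) < T') :
      Realizes (Traj.const Ω T T') (MultiStep.refl Ω T)
  | stepT {Ω Ω' : Cfg τ L} {T T₂ T₃ : τ} {σ : MultiStep Ω T₂ Ω' T₃} {s : Traj (Cfg τ L) T₂ T'}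
      (h : T ≤ T₂) (r : Realizes s σ) :
      Realizes (Traj.extend Ω T s) (MultiStep.stepT h σ)
  | stepC {Ω Ω' Ω'' : Cfg τ L} {T T₂ : τ} {σ : MultiStep Ω' T Ω'' T₂} {s : Traj (Cfg τ L) T T'}
      (c : Step Ω Action.eps T Ω') (r : Realizes s σ) :
      Realizes s (MultiStep.stepC c σ)

/-- Computable trajectories on `[T₁, T₂)`: nameless end points and a nameless trajectory which,
for every channel, is realized by a multistepping between the instantiated end points. -/
structure CompTraj {τ : Type u} [LinearOrder τ] (L : Type) (T₁ : τ) (T₂ : WithTop τ) :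
    Type (u + 1) where
  start : NCfg τ L
  finish : NCfg τ L
  ntraj : Traj (NCfg τ L) T₁ T₂
  stepTo : L → τ
  steps : (a : L) → MultiStep (start.inst a) T₁ (finish.inst a) (stepTo a)
  realize : ∀ a : L, Realizes (ntraj.map (fun Ω => Ω.inst a)) (steps a)

/-! ## Timed session types

Binding of time variables is represented by functions on `τ`: a temporal predicate `t.p` is a
function `p : τ → Prop`, a type in the scope of `t` is a function `A : τ → Ty τ`, and `A[T'/t]` is
`A T'`.  Accordingly a judgment under additional time variables and hypotheses is a universally
quantified implication. -/

/-- Timed intuitionistic linear logic session types. -/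
inductive Ty (τ : Type u) : Type u
  | one (p : τ → Prop)
  | lolli (p : τ → Prop) (A₁ A₂ : τ → Ty τ)
  | tensor (p : τ → Prop) (A₁ A₂ : τ → Ty τ)
  | amp (p : τ → Prop) (A₁ A₂ : τ → Ty τ)
  | plus (p : τ → Prop) (A₁ A₂ : τ → Ty τ)

/-- Retyping `A ⋊ B @ T`, used for forwarding. -/
inductive RetypeFwd {τ : Type u} [LinearOrder τ] : τ → Ty τ → Ty τ → Prop
  | one (T : τ) (p q : τ → Prop) :
      (∀ t, q t → p t) → (∀ t, q t → T ≤ t) →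
      RetypeFwd T (.one p) (.one q)
  | lolli (T : τ) (p q : τ → Prop) (A₁ A₂ B₁ B₂ : τ → Ty τ) :
      (∀ t, q t → p t) → (∀ t, q t → T ≤ t) →
      (∀ t, q t → RetypeFwd t (B₁ t) (A₁ t)) → (∀ t, q t → RetypeFwd t (A₂ t) (B₂ t)) →
      RetypeFwd T (.lolli p A₁ A₂) (.lolli q B₁ B₂)
  | tensor (T : τ) (p q : τ → Prop) (A₁ A₂ B₁ B₂ : τ → Ty τ) :
      (∀ t, q t → p t) → (∀ t, q t → T ≤ t) →
      (∀ t, q t → RetypeFwd t (A₁ t) (B₁ t)) → (∀ t, q t → RetypeFwd t (A₂ t) (B₂ t)) →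
      RetypeFwd T (.tensor p A₁ A₂) (.tensor q B₁ B₂)
  | amp (T : τ) (p q : τ → Prop) (A₁ A₂ B₁ B₂ : τ → Ty τ) :
      (∀ t, q t → p t) → (∀ t, q t → T ≤ t) →
      (∀ t, q t → RetypeFwd t (A₁ t) (B₁ t)) → (∀ t, q t → RetypeFwd t (A₂ t) (B₂ t)) →
      RetypeFwd T (.amp p A₁ A₂) (.amp q B₁ B₂)
  | plus (T : τ) (p q : τ → Prop) (A₁ A₂ B₁ B₂ : τ → Ty τ) :
      (∀ t, q t → p t) → (∀ t, q t → T ≤ t) →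
      (∀ t, q t → RetypeFwd t (A₁ t) (B₁ t)) → (∀ t, q t → RetypeFwd t (A₂ t) (B₂ t)) →
      RetypeFwd T (.plus p A₁ A₂) (.plus q B₁ B₂)

/-- Retyping `A ⋉ B @ T`, used for cut. -/
inductive RetypeCut {τ : Type u} [LinearOrder τ] : τ → Ty τ → Ty τ → Prop
  | one (T : τ) (p q : τ → Prop) :
      (∀ t, T ≤ t → q t → p t) →
      RetypeCut T (.one p) (.one q)
  | lolli (T : τ) (p q : τ → Prop) (A₁ A₂ B₁ B₂ : τ → Ty τ) :
      (∀ t, T ≤ t → q t → p t) →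
      (∀ t, T ≤ t → q t → RetypeCut t (B₁ t) (A₁ t)) →
      (∀ t, T ≤ t → q t → RetypeCut t (A₂ t) (B₂ t)) →
      RetypeCut T (.lolli p A₁ A₂) (.lolli q B₁ B₂)
  | tensor (T : τ) (p q : τ → Prop) (A₁ A₂ B₁ B₂ : τ → Ty τ) :
      (∀ t, T ≤ t → q t → p t) →
      (∀ t, T ≤ t → q t → RetypeCut t (A₁ t) (B₁ t)) →
      (∀ t, T ≤ t → q t → RetypeCut t (A₂ t) (B₂ t)) →
      RetypeCut T (.tensor p A₁ A₂) (.tensor q B₁ B₂)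
  | amp (T : τ) (p q : τ → Prop) (A₁ A₂ B₁ B₂ : τ → Ty τ) :
      (∀ t, T ≤ t → q t → p t) →
      (∀ t, T ≤ t → q t → RetypeCut t (A₁ t) (B₁ t)) →
      (∀ t, T ≤ t → q t → RetypeCut t (A₂ t) (B₂ t)) →
      RetypeCut T (.amp p A₁ A₂) (.amp q B₁ B₂)
  | plus (T : τ) (p q : τ → Prop) (A₁ A₂ B₁ B₂ : τ → Ty τ) :
      (∀ t, T ≤ t → q t → p t) →
      (∀ t, T ≤ t → q t → RetypeCut t (A₁ t) (B₁ t)) →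
      (∀ t, T ≤ t → q t → RetypeCut t (A₂ t) (B₂ t)) →
      RetypeCut T (.plus p A₁ A₂) (.plus q B₁ B₂)

/-! ## Terms -/

/-- Symbols: channel names and variables. -/
inductive Sym (L V : Type) : Type
  | chan (a : L)
  | var (x : V)

/-- Terms.  The suffix `R` marks provider terms, annotated by a temporal predicate `t.p` whose
variable `t` scopes over the continuations; the suffix `L` marks client terms, annotated by a
finite time and a symbol. -/
inductive Tm (τ : Type u) (L V : Type) : Type u
  | fwd (T : τ) (s : Sym L V)
  | letIn (T : τ) (x : V) (A : Ty τ) (M₁ M₂ : Tm τ L V)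
  | closeR (p : τ → Prop)
  | closeL (T : τ) (s : Sym L V) (M : Tm τ L V)
  | lolliR (p : τ → Prop) (x : V) (M : τ → Tm τ L V)
  | lolliL (T : τ) (s : Sym L V) (M₁ M₂ : Tm τ L V)
  | tensorR (p : τ → Prop) (M₁ M₂ : τ → Tm τ L V)
  | tensorL (T : τ) (s : Sym L V) (y : V) (M : Tm τ L V)
  | ampR (p : τ → Prop) (M₁ M₂ : τ → Tm τ L V)
  | ampL (T : τ) (s : Sym L V) (e : Sel) (M : Tm τ L V)
  | plusR (p : τ → Prop) (e : Sel) (M : τ → Tm τ L V)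
  | plusL (T : τ) (s : Sym L V) (M₁ M₂ : Tm τ L V)

/-- Substitutions: finite maps from variables to channel names. -/
abbrev Subst (L V : Type) : Type := Finmap (fun _ : V => L)

/-- Typing contexts: finite maps from variables to types. -/
abbrev Ctx (τ : Type u) (V : Type) : Type u := Finmap (fun _ : V => Ty τ)

/-- Applying a substitution to a symbol. -/
def Sym.subst {L V : Type} [DecidableEq V] (σ : Subst L V) : Sym L V → Sym L V
  | .chan a => .chan a
  | .var x => match σ.lookup x with
    | some a => .chan a
    | none => .var x

/-- Removing a symbol from a substitution (nothing happens for a channel name). -/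
def Sym.removeFrom {L V : Type} [DecidableEq V] (σ : Subst L V) : Sym L V → Subst L V
  | .chan _ => σ
  | .var x => σ.erase x

/-- Applying a substitution to a term. -/
def Tm.subst {τ : Type u} {L V : Type} [DecidableEq V] (σ : Subst L V) : Tm τ L V → Tm τ L V
  | .fwd T s => .fwd T (s.subst σ)
  | .letIn T x A M₁ M₂ => .letIn T x A (M₁.subst σ) (M₂.subst (σ.erase x))
  | .closeR p => .closeR p
  | .closeL T s M => .closeL T (s.subst σ) (M.subst (s.removeFrom σ))
  | .lolliR p x M => .lolliR p x (fun t => (M t).subst (σ.erase x))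
  | .lolliL T s M₁ M₂ => .lolliL T (s.subst σ) (M₁.subst σ) (M₂.subst σ)
  | .tensorR p M₁ M₂ => .tensorR p (fun t => (M₁ t).subst σ) (fun t => (M₂ t).subst σ)
  | .tensorL T s y M => .tensorL T (s.subst σ) y (M.subst (σ.erase y))
  | .ampR p M₁ M₂ => .ampR p (fun t => (M₁ t).subst σ) (fun t => (M₂ t).subst σ)
  | .ampL T s e M => .ampL T (s.subst σ) e (M.subst σ)
  | .plusR p e M => .plusR p e (fun t => (M t).subst σ)
  | .plusL T s M₁ M₂ => .plusL T (s.subst σ) (M₁.subst σ) (M₂.subst σ)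

/-- Transitions of a term `P` with providing channel `a`. -/
inductive Tm.Step {τ : Type u} {L V : Type} [DecidableEq V] :
    Tm τ L V → L → Action L → τ → Multiset (Atomic L (Tm τ L V)) → Prop
  | fwd (T : τ) (a b : L) :
      Tm.Step (.fwd T (.chan b)) a .eps T {Atomic.fwd a b}
  | letIn (T : τ) (x : V) (A : Ty τ) (M₁ M₂ : Tm τ L V) (a b' : L) :
      Tm.Step (.letIn T x A M₁ M₂) a .eps T
        {Atomic.proc b' M₁, Atomic.proc a (M₂.subst (Finmap.singleton x b'))}
  | closeL (T : τ) (a b : L) (M : Tm τ L V) :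
      Tm.Step (.closeL T (.chan b) M) a (.comm b .recv .close) T {Atomic.proc a M}
  | tensorL (T : τ) (a b c : L) (y : V) (M : Tm τ L V) :
      Tm.Step (.tensorL T (.chan b) y M) a (.comm b .recv (.chan c)) T
        {Atomic.proc a (M.subst (Finmap.singleton y c))}
  | lolliL (T : τ) (a b c : L) (M₁ M₂ : Tm τ L V) :
      Tm.Step (.lolliL T (.chan b) M₁ M₂) a (.comm b .send (.chan c)) T
        {Atomic.proc c M₁, Atomic.proc a M₂}
  | plusL (T : τ) (a b : L) (e : Sel) (M₁ M₂ : Tm τ L V) :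
      Tm.Step (.plusL T (.chan b) M₁ M₂) a (.comm b .recv (.sel e)) T
        {Atomic.proc a (e.pick M₁ M₂)}
  | ampL (T : τ) (a b : L) (e : Sel) (M : Tm τ L V) :
      Tm.Step (.ampL T (.chan b) e M) a (.comm b .send (.sel e)) T {Atomic.proc a M}
  | closeR (p : τ → Prop) (T : τ) (a : L) : p T →
      Tm.Step (.closeR p) a (.comm a .send .close) T 0
  | tensorR (p : τ → Prop) (T : τ) (a c : L) (M₁ M₂ : τ → Tm τ L V) : p T →
      Tm.Step (.tensorR p M₁ M₂) a (.comm a .send (.chan c)) T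
        {Atomic.proc a (M₂ T), Atomic.proc c (M₁ T)}
  | lolliR (p : τ → Prop) (T : τ) (a b : L) (x : V) (M : τ → Tm τ L V) : p T →
      Tm.Step (.lolliR p x M) a (.comm a .recv (.chan b)) T
        {Atomic.proc a ((M T).subst (Finmap.singleton x b))}
  | plusR (p : τ → Prop) (T : τ) (a : L) (e : Sel) (M : τ → Tm τ L V) : p T →
      Tm.Step (.plusR p e M) a (.comm a .send (.sel e)) T {Atomic.proc a (M T)}
  | ampR (p : τ → Prop) (T : τ) (a : L) (e : Sel) (M₁ M₂ : τ → Tm τ L V) : p T →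
      Tm.Step (.ampR p M₁ M₂) a (.comm a .recv (.sel e)) T
        {Atomic.proc a (e.pick (M₁ T) (M₂ T))}

/-- The language of terms. -/
def tmLang (τ : Type u) (L V : Type) [DecidableEq V] : ProcLang τ L where
  NObj := Tm τ L V
  step := Tm.Step

/-- `Typed T Γ M A` is the typing judgment `Γ ⊢ M @ T :: A`.  Contexts are linear: unions are
disjoint, and a variable that extends a context is not yet in it. -/
inductive Typed {τ : Type u} [LinearOrder τ] {L V : Type} [DecidableEq V] :
    τ → Ctx τ V → Tm τ L V → Ty τ → Prop
  | cut (T : τ) (Γ₁ Γ₂ : Ctx τ V) (x : V) (A A' C : Ty τ) (M₁ M₂ : Tm τ L V) :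
      Γ₁.Disjoint Γ₂ → x ∉ Γ₂ →
      Typed T Γ₁ M₁ A → Typed T (Γ₂.insert x A') M₂ C → RetypeCut T A A' →
      Typed T (Γ₁ ∪ Γ₂) (.letIn T x A' M₁ M₂) C
  | fwd (T : τ) (x : V) (A A' : Ty τ) :
      RetypeFwd T A A' →
      Typed T (Finmap.singleton x A) (.fwd T (.var x)) A'
  | oneR (T : τ) (p : τ → Prop) :
      (∀ t, p t → T ≤ t) →
      Typed T ∅ (.closeR p) (.one p)
  | oneL (T T' : τ) (Γ : Ctx τ V) (x : V) (p : τ → Prop) (M : Tm τ L V) (C : Ty τ) :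
      x ∉ Γ → Typed T' Γ M C → T ≤ T' → p T' →
      Typed T (Γ.insert x (.one p)) (.closeL T' (.var x) M) C
  | lolliR (T : τ) (Γ : Ctx τ V) (x : V) (p : τ → Prop) (A₁ A₂ : τ → Ty τ)
      (M : τ → Tm τ L V) :
      x ∉ Γ → (∀ t, p t → Typed t (Γ.insert x (A₁ t)) (M t) (A₂ t)) →
      (∀ t, p t → T ≤ t) →
      Typed T Γ (.lolliR p x M) (.lolli p A₁ A₂)
  | lolliL (T T' : τ) (Γ₁ Γ₂ : Ctx τ V) (x : V) (p : τ → Prop) (A₁ A₂ : τ → Ty τ) (C : Ty τ)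
      (M₁ M₂ : Tm τ L V) :
      Γ₁.Disjoint Γ₂ → x ∉ Γ₁ → x ∉ Γ₂ →
      Typed T' Γ₁ M₁ (A₁ T') → Typed T' (Γ₂.insert x (A₂ T')) M₂ C → T ≤ T' → p T' →
      Typed T ((Γ₁ ∪ Γ₂).insert x (.lolli p A₁ A₂)) (.lolliL T' (.var x) M₁ M₂) C
  | tensorR (T : τ) (Γ₁ Γ₂ : Ctx τ V) (p : τ → Prop) (A₁ A₂ : τ → Ty τ)
      (M₁ M₂ : τ → Tm τ L V) :
      Γ₁.Disjoint Γ₂ →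
      (∀ t, p t → Typed t Γ₁ (M₁ t) (A₁ t)) → (∀ t, p t → Typed t Γ₂ (M₂ t) (A₂ t)) →
      (∀ t, p t → T ≤ t) →
      Typed T (Γ₁ ∪ Γ₂) (.tensorR p M₁ M₂) (.tensor p A₁ A₂)
  | tensorL (T T' : τ) (Γ : Ctx τ V) (x y : V) (p : τ → Prop) (A₁ A₂ : τ → Ty τ) (C : Ty τ)
      (M : Tm τ L V) :
      x ∉ Γ → y ∉ Γ → x ≠ y →
      Typed T' ((Γ.insert x (A₂ T')).insert y (A₁ T')) M C → T ≤ T' → p T' →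
      Typed T (Γ.insert x (.tensor p A₁ A₂)) (.tensorL T' (.var x) y M) C
  | ampR (T : τ) (Γ : Ctx τ V) (p : τ → Prop) (A₁ A₂ : τ → Ty τ) (M₁ M₂ : τ → Tm τ L V) :
      (∀ t, p t → Typed t Γ (M₁ t) (A₁ t)) → (∀ t, p t → Typed t Γ (M₂ t) (A₂ t)) →
      (∀ t, p t → T ≤ t) →
      Typed T Γ (.ampR p M₁ M₂) (.amp p A₁ A₂)
  | ampL (T T' : τ) (Γ : Ctx τ V) (x : V) (p : τ → Prop) (A₁ A₂ : τ → Ty τ) (C : Ty τ)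
      (e : Sel) (M : Tm τ L V) :
      x ∉ Γ → Typed T' (Γ.insert x (e.pick (A₁ T') (A₂ T'))) M C → T ≤ T' → p T' →
      Typed T (Γ.insert x (.amp p A₁ A₂)) (.ampL T' (.var x) e M) C
  | plusR (T : τ) (Γ : Ctx τ V) (p : τ → Prop) (A₁ A₂ : τ → Ty τ) (e : Sel)
      (M : τ → Tm τ L V) :
      (∀ t, p t → Typed t Γ (M t) (e.pick (A₁ t) (A₂ t))) → (∀ t, p t → T ≤ t) →
      Typed T Γ (.plusR p e M) (.plus p A₁ A₂)
  | plusL (T T' : τ) (Γ : Ctx τ V) (x : V) (p : τ → Prop) (A₁ A₂ : τ → Ty τ) (C : Ty τ)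
      (M₁ M₂ : Tm τ L V) :
      x ∉ Γ → Typed T' (Γ.insert x (A₁ T')) M₁ C → Typed T' (Γ.insert x (A₂ T')) M₂ C →
      T ≤ T' → p T' →
      Typed T (Γ.insert x (.plus p A₁ A₂)) (.plusL T' (.var x) M₁ M₂) C

end TimedSession

/-!
A well-typed process runs in a configuration that is a tree: each process is linked to the
providers of its free variables, and these recursively to theirs (`WellTyped`).  Two facts about
time drive the proof.  A process cannot be demanded by its client before its typing time
(`Typed.le_of_pred`), and as the continuation of a client term is typed at the time of the client
action, a process that has to act at a time `c` cannot be demanded before `c` either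
(`Typed.clock_le`).  A process without such a time is a provider term and simply waits.

So the tree can be scheduled globally.  Let time pass to the first time `t` at which some process is
due; cut retyping persists (`RetypeCut.mono`) and no process misses its time.  At `t`, take a lowest
due process.  Cuts and forwards can be performed at once.  A client term acts on a provider which is
demanded at `t`.  If that provider had a time to act, it would be at most `t`, hence `t`, but nothing
below the client is due at `t`.  So it is a provider term, its type matches up to `⋉`, and the two
communicate (`WellTyped.advance_root`, `WellTyped.advance`).
Forwarding turns `⋊` into `⋉`, and `⋉` is transitive, so the resulting tree is well typed again.

Each round replaces processes by finitely many processes of smaller rank, or removes a forward.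
Ranks are ordinals, since a term branches over all times, and multisets of ranks are well-founded in
the Dershowitz–Manna order.  Hence finitely many rounds lead to the observation time `T'`
(`WellTyped.reaches`).  There the root, demanded at `T'`, must be a provider term of type `1`, which
can close, and nothing else is left.  The trajectory stays constant from `T'` on.

Every step merely selects the processes that the tree links, and the frame rule admits any further
processes, so coincidences of channel names do no harm.  This matters because one and the same
nameless trajectory has to be realized for every name of the root channel.
-/

namespace TimedSession

universe u

variable {τ : Type u} {L V : Type}

/-! ### Retyping -/

/-- The temporal predicate that annotates the outermost connective of a type. -/
def Ty.pred : Ty τ → τ → Prop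
  | .one p => p
  | .lolli p _ _ => p
  | .tensor p _ _ => p
  | .amp p _ _ => p
  | .plus p _ _ => p

theorem RetypeCut.refl [LinearOrder τ] (A : Ty τ) (T : τ) : RetypeCut T A A := by
  induction A generalizing T with
  | one p => exact .one _ _ _ fun _ _ h => h
  | lolli p A₁ A₂ ih₁ ih₂ =>
    exact .lolli _ _ _ _ _ _ _ (fun _ _ h => h) (fun t _ _ => ih₁ t t) (fun t _ _ => ih₂ t t)
  | tensor p A₁ A₂ ih₁ ih₂ =>
    exact .tensor _ _ _ _ _ _ _ (fun _ _ h => h) (fun t _ _ => ih₁ t t) (fun t _ _ => ih₂ t t)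
  | amp p A₁ A₂ ih₁ ih₂ =>
    exact .amp _ _ _ _ _ _ _ (fun _ _ h => h) (fun t _ _ => ih₁ t t) (fun t _ _ => ih₂ t t)
  | plus p A₁ A₂ ih₁ ih₂ =>
    exact .plus _ _ _ _ _ _ _ (fun _ _ h => h) (fun t _ _ => ih₁ t t) (fun t _ _ => ih₂ t t)

theorem RetypeCut.trans [LinearOrder τ] {T : τ} {A B C : Ty τ} (h₁ : RetypeCut T A B)
    (h₂ : RetypeCut T B C) : RetypeCut T A C := by
  induction B generalizing T A C with
  | one p =>
    cases h₁ with | one _ _ _ hp => cases h₂ with | one _ _ _ hq =>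
    exact .one _ _ _ fun t ht h => hp t ht (hq t ht h)
  | lolli p B₁ B₂ ih₁ ih₂ =>
    cases h₁ with | lolli _ _ _ _ _ _ _ hp a₁ a₂ =>
    cases h₂ with | lolli _ _ _ _ _ _ _ hq b₁ b₂ =>
    exact .lolli _ _ _ _ _ _ _ (fun t ht h => hp t ht (hq t ht h))
      (fun t ht h => ih₁ t (b₁ t ht h) (a₁ t ht (hq t ht h)))
      (fun t ht h => ih₂ t (a₂ t ht (hq t ht h)) (b₂ t ht h))
  | tensor p B₁ B₂ ih₁ ih₂ =>
    cases h₁ with | tensor _ _ _ _ _ _ _ hp a₁ a₂ =>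
    cases h₂ with | tensor _ _ _ _ _ _ _ hq b₁ b₂ =>
    exact .tensor _ _ _ _ _ _ _ (fun t ht h => hp t ht (hq t ht h))
      (fun t ht h => ih₁ t (a₁ t ht (hq t ht h)) (b₁ t ht h))
      (fun t ht h => ih₂ t (a₂ t ht (hq t ht h)) (b₂ t ht h))
  | amp p B₁ B₂ ih₁ ih₂ =>
    cases h₁ with | amp _ _ _ _ _ _ _ hp a₁ a₂ =>
    cases h₂ with | amp _ _ _ _ _ _ _ hq b₁ b₂ =>
    exact .amp _ _ _ _ _ _ _ (fun t ht h => hp t ht (hq t ht h))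
      (fun t ht h => ih₁ t (a₁ t ht (hq t ht h)) (b₁ t ht h))
      (fun t ht h => ih₂ t (a₂ t ht (hq t ht h)) (b₂ t ht h))
  | plus p B₁ B₂ ih₁ ih₂ =>
    cases h₁ with | plus _ _ _ _ _ _ _ hp a₁ a₂ =>
    cases h₂ with | plus _ _ _ _ _ _ _ hq b₁ b₂ =>
    exact .plus _ _ _ _ _ _ _ (fun t ht h => hp t ht (hq t ht h))
      (fun t ht h => ih₁ t (a₁ t ht (hq t ht h)) (b₁ t ht h))
      (fun t ht h => ih₂ t (a₂ t ht (hq t ht h)) (b₂ t ht h))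

/-- Cut retyping only looks at times from `T` on, so it persists as time passes. -/
theorem RetypeCut.mono [LinearOrder τ] {T T' : τ} {A B : Ty τ} (hT : T ≤ T')
    (h : RetypeCut T A B) : RetypeCut T' A B := by
  cases h with
  | one _ _ _ hp => exact .one _ _ _ fun t ht => hp t (hT.trans ht)
  | lolli _ _ _ _ _ _ _ hp a₁ a₂ =>
    exact .lolli _ _ _ _ _ _ _ (fun t ht => hp t (hT.trans ht)) (fun t ht => a₁ t (hT.trans ht))
      (fun t ht => a₂ t (hT.trans ht))
  | tensor _ _ _ _ _ _ _ hp a₁ a₂ =>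
    exact .tensor _ _ _ _ _ _ _ (fun t ht => hp t (hT.trans ht)) (fun t ht => a₁ t (hT.trans ht))
      (fun t ht => a₂ t (hT.trans ht))
  | amp _ _ _ _ _ _ _ hp a₁ a₂ =>
    exact .amp _ _ _ _ _ _ _ (fun t ht => hp t (hT.trans ht)) (fun t ht => a₁ t (hT.trans ht))
      (fun t ht => a₂ t (hT.trans ht))
  | plus _ _ _ _ _ _ _ hp a₁ a₂ =>
    exact .plus _ _ _ _ _ _ _ (fun t ht => hp t (hT.trans ht)) (fun t ht => a₁ t (hT.trans ht))
      (fun t ht => a₂ t (hT.trans ht))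

theorem RetypeFwd.toCut [LinearOrder τ] {T : τ} {A B : Ty τ} (h : RetypeFwd T A B) :
    RetypeCut T A B := by
  induction h with
  | one T p q hp _ => exact .one _ _ _ fun t _ => hp t
  | lolli T p q A₁ A₂ B₁ B₂ hp _ _ _ ih₁ ih₂ =>
    exact .lolli _ _ _ _ _ _ _ (fun t _ => hp t) (fun t _ => ih₁ t) (fun t _ => ih₂ t)
  | tensor T p q A₁ A₂ B₁ B₂ hp _ _ _ ih₁ ih₂ =>
    exact .tensor _ _ _ _ _ _ _ (fun t _ => hp t) (fun t _ => ih₁ t) (fun t _ => ih₂ t)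
  | amp T p q A₁ A₂ B₁ B₂ hp _ _ _ ih₁ ih₂ =>
    exact .amp _ _ _ _ _ _ _ (fun t _ => hp t) (fun t _ => ih₁ t) (fun t _ => ih₂ t)
  | plus T p q A₁ A₂ B₁ B₂ hp _ _ _ ih₁ ih₂ =>
    exact .plus _ _ _ _ _ _ _ (fun t _ => hp t) (fun t _ => ih₁ t) (fun t _ => ih₂ t)

theorem RetypeCut.pred [LinearOrder τ] {T t : τ} {A B : Ty τ} (h : RetypeCut T A B) (ht : T ≤ t)
    (hB : B.pred t) : A.pred t := by
  cases h with
  | one _ _ _ hp => exact hp t ht hB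
  | lolli _ _ _ _ _ _ _ hp => exact hp t ht hB
  | tensor _ _ _ _ _ _ _ hp => exact hp t ht hB
  | amp _ _ _ _ _ _ _ hp => exact hp t ht hB
  | plus _ _ _ _ _ _ _ hp => exact hp t ht hB

theorem RetypeFwd.le_of_pred [LinearOrder τ] {T t : τ} {A B : Ty τ} (h : RetypeFwd T A B)
    (hB : B.pred t) : T ≤ t := by
  cases h with
  | one _ _ _ _ hq => exact hq t hB
  | lolli _ _ _ _ _ _ _ _ hq => exact hq t hB
  | tensor _ _ _ _ _ _ _ _ hq => exact hq t hB
  | amp _ _ _ _ _ _ _ _ hq => exact hq t hB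
  | plus _ _ _ _ _ _ _ _ hq => exact hq t hB

/-! ### Clocks and ranks of terms -/

/-- The finite time at which a term is due to act.  Provider terms wait for their client, so they
have none. -/
def Tm.clock : Tm τ L V → Option τ
  | .fwd T _ => some T
  | .letIn T _ _ _ _ => some T
  | .closeR _ => none
  | .closeL T _ _ => some T
  | .lolliR _ _ _ => none
  | .lolliL T _ _ _ => some T
  | .tensorR _ _ _ => none
  | .tensorL T _ _ _ => some T
  | .ampR _ _ _ => none
  | .ampL T _ _ _ => some T
  | .plusR _ _ _ => none
  | .plusL T _ _ _ => some T

/-- The height of a term as a well-founded tree, which branches over all times below a temporal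
binder. -/
noncomputable def Tm.rank : Tm τ L V → Ordinal.{u}
  | .fwd _ _ => 0
  | .letIn _ _ _ M₁ M₂ => max M₁.rank M₂.rank + 1
  | .closeR _ => 0
  | .closeL _ _ M => M.rank + 1
  | .lolliR _ _ M => (⨆ t, (M t).rank) + 1
  | .lolliL _ _ M₁ M₂ => max M₁.rank M₂.rank + 1
  | .tensorR _ M₁ M₂ => (⨆ t, max (M₁ t).rank (M₂ t).rank) + 1
  | .tensorL _ _ _ M => M.rank + 1
  | .ampR _ M₁ M₂ => (⨆ t, max (M₁ t).rank (M₂ t).rank) + 1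
  | .ampL _ _ _ M => M.rank + 1
  | .plusR _ _ M => (⨆ t, (M t).rank) + 1
  | .plusL _ _ M₁ M₂ => max M₁.rank M₂.rank + 1

theorem lt_iSup_add_one (f : τ → Ordinal.{u}) (t : τ) : f t < (⨆ s, f s) + 1 :=
  Order.lt_add_one_iff.mpr (le_ciSup (f := f) Ordinal.bddAbove_of_small t)

@[simp]
theorem Tm.clock_subst [DecidableEq V] (σ : Subst L V) (M : Tm τ L V) :
    (M.subst σ).clock = M.clock := by
  cases M <;> rfl

@[simp]
theorem Tm.rank_subst [DecidableEq V] (σ : Subst L V) (M : Tm τ L V) :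
    (M.subst σ).rank = M.rank := by
  induction M generalizing σ <;> simp_all [Tm.subst, Tm.rank]

theorem Typed.le_clock [LinearOrder τ] [DecidableEq V] {T c : τ} {Γ : Ctx τ V} {M : Tm τ L V}
    {A : Ty τ} (h : Typed T Γ M A) (hc : M.clock = some c) : T ≤ c := by
  cases h <;> simp_all [Tm.clock]

/-- A term is never demanded before its typing time. -/
theorem Typed.le_of_pred [LinearOrder τ] [DecidableEq V] {T t : τ} {Γ : Ctx τ V} {M : Tm τ L V}
    {A : Ty τ} (h : Typed T Γ M A) (ht : A.pred t) : T ≤ t := by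
  induction h with
  | cut _ _ _ _ _ _ _ _ _ _ _ _ _ _ _ ih => exact ih ht
  | fwd _ _ _ _ h => exact h.le_of_pred ht
  | oneR _ _ h => exact h t ht
  | oneL _ _ _ _ _ _ _ _ _ h _ ih => exact h.trans (ih ht)
  | lolliR _ _ _ _ _ _ _ _ _ h => exact h t ht
  | lolliL _ _ _ _ _ _ _ _ _ _ _ _ _ _ _ _ h _ _ ih => exact h.trans (ih ht)
  | tensorR _ _ _ _ _ _ _ _ _ _ _ h => exact h t ht
  | tensorL _ _ _ _ _ _ _ _ _ _ _ _ _ _ h _ ih => exact h.trans (ih ht)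
  | ampR _ _ _ _ _ _ _ _ _ h => exact h t ht
  | ampL _ _ _ _ _ _ _ _ _ _ _ _ h _ ih => exact h.trans (ih ht)
  | plusR _ _ _ _ _ _ _ _ h => exact h t ht
  | plusL _ _ _ _ _ _ _ _ _ _ _ _ _ h _ ih => exact h.trans (ih ‹_›)

/-- A term that is due to act does so no later than its first demand: the continuation of a client
term is typed at the time of the client action. -/
theorem Typed.clock_le [LinearOrder τ] [DecidableEq V] {T t c : τ} {Γ : Ctx τ V} {M : Tm τ L V}
    {A : Ty τ} (h : Typed T Γ M A) (hc : M.clock = some c) (ht : A.pred t) : c ≤ t := by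
  cases h with
  | cut _ _ _ _ _ _ _ _ _ _ _ _ h => cases hc; exact h.le_of_pred ht
  | fwd _ _ _ _ h => cases hc; exact h.le_of_pred ht
  | oneL _ _ _ _ _ _ _ _ h => cases hc; exact h.le_of_pred ht
  | lolliL _ _ _ _ _ _ _ _ _ _ _ _ _ _ _ h => cases hc; exact h.le_of_pred ht
  | tensorL _ _ _ _ _ _ _ _ _ _ _ _ _ h => cases hc; exact h.le_of_pred ht
  | ampL _ _ _ _ _ _ _ _ _ _ _ h => cases hc; exact h.le_of_pred ht
  | plusL _ _ _ _ _ _ _ _ _ _ _ h => cases hc; exact h.le_of_pred ht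
  | oneR | lolliR | tensorR | ampR | plusR => cases hc

/-! ### Substitution -/

theorem Tm.subst_empty [DecidableEq V] (M : Tm τ L V) : M.subst ∅ = M := by
  have he (x : V) : (∅ : Subst L V).erase x = ∅ := by
    refine Finmap.ext_lookup fun y => ?_
    by_cases h : y = x
    · subst h; simp
    · simp [Finmap.lookup_erase_ne h]
  have hs (s : Sym L V) : s.subst (∅ : Subst L V) = s := by cases s <;> simp [Sym.subst]
  have hr (s : Sym L V) : s.removeFrom (∅ : Subst L V) = ∅ := by
    cases s <;> simp [Sym.removeFrom, he]
  induction M <;> simp_all [Tm.subst]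

theorem erase_union [DecidableEq V] (x : V) (σ₁ σ₂ : Subst L V) :
    (σ₁ ∪ σ₂).erase x = σ₁.erase x ∪ σ₂.erase x := by
  refine Finmap.ext_lookup fun y => ?_
  by_cases h : y = x
  · subst h
    rw [Finmap.lookup_erase, Finmap.lookup_union_right (by simp), Finmap.lookup_erase]
  · rw [Finmap.lookup_erase_ne h]
    by_cases h₁ : y ∈ σ₁
    · rw [Finmap.lookup_union_left h₁, Finmap.lookup_union_left (by simp [h, h₁]),
        Finmap.lookup_erase_ne h]
    · rw [Finmap.lookup_union_right h₁, Finmap.lookup_union_right (by simp [h₁]),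
        Finmap.lookup_erase_ne h]

theorem disjoint_erase [DecidableEq V] (x : V) {σ₁ σ₂ : Subst L V} (h : σ₁.Disjoint σ₂) :
    (σ₁.erase x).Disjoint (σ₂.erase x) := fun y h₁ h₂ =>
  h y (Finmap.mem_erase.mp h₁).2 (Finmap.mem_erase.mp h₂).2

theorem erase_of_notMem [DecidableEq V] {x : V} {σ : Subst L V} (h : x ∉ σ) : σ.erase x = σ := by
  refine Finmap.ext_lookup fun y => ?_
  by_cases hy : y = x
  · subst hy
    rw [Finmap.lookup_erase, Finmap.lookup_eq_none.mpr h]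
  · rw [Finmap.lookup_erase_ne hy]

theorem Sym.subst_subst [DecidableEq V] {σ₁ σ₂ : Subst L V} (s : Sym L V) :
    (s.subst σ₁).subst σ₂ = s.subst (σ₁ ∪ σ₂) := by
  cases s with
  | chan a => rfl
  | var x =>
    by_cases h : x ∈ σ₁
    · obtain ⟨b, hb⟩ := Finmap.mem_iff.mp h
      simp [Sym.subst, Finmap.lookup_union_left h, hb]
    · simp [Sym.subst, Finmap.lookup_union_right h, Finmap.lookup_eq_none.mpr h]

/-- After the first substitution has replaced the symbol of a client term, the second one is no
longer pruned by it; disjointness makes up for that. -/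
theorem Sym.removeFrom_subst [DecidableEq V] {σ₁ σ₂ : Subst L V} (h : σ₁.Disjoint σ₂)
    (s : Sym L V) :
    (s.removeFrom σ₁).Disjoint ((s.subst σ₁).removeFrom σ₂) ∧
      s.removeFrom σ₁ ∪ (s.subst σ₁).removeFrom σ₂ = s.removeFrom (σ₁ ∪ σ₂) := by
  cases s with
  | chan a => exact ⟨h, rfl⟩
  | var x =>
    have key : (Sym.subst σ₁ (.var x)).removeFrom σ₂ = σ₂.erase x := by
      by_cases hx : x ∈ σ₁
      · obtain ⟨b, hb⟩ := Finmap.mem_iff.mp hx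
        simp [Sym.subst, hb, Sym.removeFrom, erase_of_notMem (h x hx)]
      · simp [Sym.subst, Finmap.lookup_eq_none.mpr hx, Sym.removeFrom]
    rw [key]
    exact ⟨disjoint_erase x h, (erase_union x σ₁ σ₂).symm⟩

theorem Tm.subst_subst [DecidableEq V] (M : Tm τ L V) {σ₁ σ₂ : Subst L V} (h : σ₁.Disjoint σ₂) :
    (M.subst σ₁).subst σ₂ = M.subst (σ₁ ∪ σ₂) := by
  induction M generalizing σ₁ σ₂ with
  | fwd T s => simp [Tm.subst, Sym.subst_subst]
  | letIn T x A M₁ M₂ ih₁ ih₂ =>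
    simp [Tm.subst, ih₁ h, ih₂ (disjoint_erase x h), erase_union]
  | closeR p => rfl
  | closeL T s M ih =>
    simp [Tm.subst, Sym.subst_subst, ih (Sym.removeFrom_subst h s).1,
      (Sym.removeFrom_subst h s).2]
  | lolliR p x M ih => simp [Tm.subst, ih _ (disjoint_erase x h), erase_union]
  | lolliL T s M₁ M₂ ih₁ ih₂ => simp [Tm.subst, Sym.subst_subst, ih₁ h, ih₂ h]
  | tensorR p M₁ M₂ ih₁ ih₂ => simp [Tm.subst, ih₁ _ h, ih₂ _ h]
  | tensorL T s y M ih =>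
    simp [Tm.subst, Sym.subst_subst, ih (disjoint_erase y h), erase_union]
  | ampR p M₁ M₂ ih₁ ih₂ => simp [Tm.subst, ih₁ _ h, ih₂ _ h]
  | ampL T s e M ih => simp [Tm.subst, Sym.subst_subst, ih h]
  | plusR p e M ih => simp [Tm.subst, ih _ h]
  | plusL T s M₁ M₂ ih₁ ih₂ => simp [Tm.subst, Sym.subst_subst, ih₁ h, ih₂ h]

theorem Tm.subst_erase_singleton [DecidableEq V] (M : Tm τ L V) (σ : Subst L V) (x : V) (b : L) :
    (M.subst (σ.erase x)).subst (Finmap.singleton x b) = M.subst (σ.insert x b) := by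
  rw [Tm.subst_subst]
  · congr 1
    refine Finmap.ext_lookup fun y => ?_
    by_cases hy : y = x
    · subst hy
      rw [Finmap.lookup_union_right (by simp), Finmap.lookup_singleton_eq, Finmap.lookup_insert]
    · rw [Finmap.lookup_union_left_of_not_in (by simp [hy]), Finmap.lookup_erase_ne hy,
        Finmap.lookup_insert_of_ne _ hy]
  · intro y h₁ h₂
    rw [Finmap.mem_singleton] at h₂
    exact (Finmap.mem_erase.mp h₁).1 h₂

/-! ### Typed process trees -/

/-- Processes together with their providing channels.  Between two rounds of evaluation every
forwarding object has been resolved, so a configuration consists of such pairs. -/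
abbrev Procs (τ : Type u) (L V : Type) : Type u := Multiset (L × Tm τ L V)

/-- `WellTyped t Ω P A`: at time `t` the process `P` provides `A`, and `Ω` consists of the
providers, recursively, of its free variables, which a substitution has replaced by channels.
A provider of type `B` may serve a variable of type `C` if `B ⋉ C @ t`, and no process has missed
the time at which it is due.  Only the tree structure links clients to providers: channel names
need not be distinct. -/
inductive WellTyped [LinearOrder τ] [DecidableEq V] (t : τ) :
    Procs τ L V → Tm τ L V → Ty τ → Prop
  | mk (T : τ) (Γ : Ctx τ V) (σ : Subst L V) (M : Tm τ L V) (A : Ty τ) (b : V → L)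
      (Ω : V → Procs τ L V) (N : V → Tm τ L V) (B : V → Ty τ) :
      Typed T Γ M A → (∀ c, M.clock = some c → t ≤ c) →
      (∀ x ∈ Γ, σ.lookup x = some (b x)) →
      (∀ x ∈ Γ, WellTyped t (Ω x) (N x) (B x)) →
      (∀ x C, Γ.lookup x = some C → RetypeCut t (B x) C) →
      WellTyped t (∑ x ∈ Γ.keys, (Ω x + {(b x, N x)})) (M.subst σ) A

theorem keys_insert [DecidableEq V] {Γ : Ctx τ V} {x : V} {C : Ty τ} :
    (Γ.insert x C).keys = Insert.insert x Γ.keys := by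
  ext y
  simp [Finmap.mem_keys]

section

variable [LinearOrder τ] [DecidableEq V] {t : τ}

/-- `Provider t b C Ω`: the processes `Ω` are a well-typed tree whose root serves the channel `b`
at type `C`. -/
def Provider (t : τ) (b : L) (C : Ty τ) (Ω : Procs τ L V) : Prop :=
  ∃ Ω' N B, Ω = Ω' + {(b, N)} ∧ WellTyped t Ω' N B ∧ RetypeCut t B C

/-- `Env t Γ σ Ω`: the processes `Ω` are providers of the channels that `σ` assigns to the
variables of `Γ`, one tree for each variable. -/
def Env (t : τ) (Γ : Ctx τ V) (σ : Subst L V) (Ω : Procs τ L V) : Prop :=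
  ∃ f : V → Procs τ L V, Ω = ∑ x ∈ Γ.keys, f x ∧
    ∀ x C, Γ.lookup x = some C → ∃ b, σ.lookup x = some b ∧ Provider t b C (f x)

theorem wellTyped_iff [Nonempty L] {Ω : Procs τ L V} {P : Tm τ L V} {A : Ty τ} :
    WellTyped t Ω P A ↔ ∃ T Γ σ M, P = M.subst σ ∧ Typed T Γ M A ∧
      (∀ c, M.clock = some c → t ≤ c) ∧ Env t Γ σ Ω := by
  constructor
  · rintro ⟨T, Γ, σ, M, A, b, Ω, N, B, hM, hc, hb, hN, hB⟩
    refine ⟨T, Γ, σ, M, rfl, hM, hc, _, rfl, fun x C hx => ?_⟩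
    have hx' := Finmap.mem_of_lookup_eq_some hx
    exact ⟨b x, hb x hx', Ω x, N x, B x, rfl, hN x hx', hB x C hx⟩
  · rintro ⟨T, Γ, σ, M, rfl, hM, hc, f, rfl, hf⟩
    have hf' : ∀ x, ∃ b Ω N B, x ∈ Γ → σ.lookup x = some b ∧ f x = Ω + {(b, N)} ∧
        WellTyped t Ω N B ∧ ∀ C, Γ.lookup x = some C → RetypeCut t B C := by
      intro x
      by_cases hx : x ∈ Γ
      · obtain ⟨C, hC⟩ := Finmap.mem_iff.mp hx
        obtain ⟨b, hb, Ω, N, B, h₁, h₂, h₃⟩ := hf x C hC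
        refine ⟨b, Ω, N, B, fun _ => ⟨hb, h₁, h₂, fun C' hC' => ?_⟩⟩
        cases hC.symm.trans hC'
        exact h₃
      -- Outside `Γ` the data are not constrained.
      · exact ⟨Classical.arbitrary L, 0, M, A, fun h => absurd h hx⟩
    choose b Ω N B h using hf'
    rw [Finset.sum_congr rfl fun x hx => (h x (Finmap.mem_keys.mp hx)).2.1]
    exact .mk T Γ σ M A b Ω N B hM hc (fun x hx => (h x hx).1) (fun x hx => (h x hx).2.2.1)
      (fun x C hx => (h x (Finmap.mem_of_lookup_eq_some hx)).2.2.2 C hx)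

theorem WellTyped.of_typed [Nonempty L] {Γ : Ctx τ V} {σ : Subst L V} {Ω : Procs τ L V}
    {M : Tm τ L V} {A : Ty τ} (hM : Typed t Γ M A) (h : Env t Γ σ Ω) :
    WellTyped t Ω (M.subst σ) A :=
  wellTyped_iff.mpr ⟨t, Γ, σ, M, rfl, hM, fun _ hc => hM.le_clock hc, h⟩

/-- Time may pass until the first process is due. -/
theorem WellTyped.mono {t' : τ} (ht : t ≤ t') {Ω : Procs τ L V} {P : Tm τ L V} {A : Ty τ}
    (h : WellTyped t Ω P A) (hP : ∀ c, P.clock = some c → t' ≤ c)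
    (hΩ : ∀ y ∈ Ω, ∀ c, y.2.clock = some c → t' ≤ c) : WellTyped t' Ω P A := by
  induction h with
  | mk T Γ σ M A b Ω N B hM hc hb hN hB ih =>
    have hmem : ∀ x ∈ Γ, ∀ y ∈ Ω x + {(b x, N x)}, ∀ c, y.2.clock = some c → t' ≤ c :=
      fun x hx y hy => hΩ y (Multiset.mem_sum.mpr ⟨x, Finmap.mem_keys.mpr hx, hy⟩)
    refine .mk T Γ σ M A b Ω N B hM (by simpa using hP) hb (fun x hx => ?_)
      (fun x C hx => (hB x C hx).mono ht)
    exact ih x hx (fun c => hmem x hx (b x, N x) (by simp) c)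
      (fun y hy => hmem x hx y (by simp [hy]))

theorem WellTyped.le_clock {Ω : Procs τ L V} {P : Tm τ L V} {A : Ty τ} (h : WellTyped t Ω P A)
    {c : τ} (hc : P.clock = some c) : t ≤ c := by
  cases h with
  | mk T Γ σ M A b Ω N B hM hc' => exact hc' c (by simpa using hc)

theorem WellTyped.clock_le {Ω : Procs τ L V} {P : Tm τ L V} {A : Ty τ} (h : WellTyped t Ω P A)
    {c s : τ} (hc : P.clock = some c) (hs : A.pred s) : c ≤ s := by
  cases h with
  | mk T Γ σ M A b Ω N B hM => exact hM.clock_le (by simpa using hc) hs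

theorem WellTyped.le_clock_of_mem {Ω : Procs τ L V} {P : Tm τ L V} {A : Ty τ}
    (h : WellTyped t Ω P A) {y : L × Tm τ L V} (hy : y ∈ Ω) {c : τ} (hc : y.2.clock = some c) :
    t ≤ c := by
  induction h with
  | mk T Γ σ M A b Ω N B _ _ _ hN _ ih =>
    obtain ⟨x, hx, hy⟩ := Multiset.mem_sum.mp hy
    rw [Finmap.mem_keys] at hx
    rcases Multiset.mem_add.mp hy with hy | hy
    · exact ih x hx hy
    · rw [Multiset.mem_singleton] at hy
      subst hy
      exact (hN x hx).le_clock hc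

/-- A process is demanded no earlier than it is due.  So if it serves a client now and is not
itself due now, then it is a provider term. -/
theorem WellTyped.clock_eq_none {Ω : Procs τ L V} {N : Tm τ L V} {B C : Ty τ}
    (h : WellTyped t Ω N B) (hB : RetypeCut t B C) (hC : C.pred t) (hN : N.clock ≠ some t) :
    N.clock = none := by
  cases hc : N.clock with
  | none => rfl
  | some c =>
    have := h.clock_le hc (hB.pred le_rfl hC)
    have := h.le_clock hc
    exact absurd (hc.trans (congrArg some (le_antisymm ‹c ≤ t› this))) hN

theorem Env.empty (σ : Subst L V) : Env t ∅ σ (0 : Procs τ L V) :=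
  ⟨fun _ => 0, by simp, fun x C h => by simp at h⟩

theorem Env.congr {Γ : Ctx τ V} {σ σ' : Subst L V} {Ω : Procs τ L V} (h : Env t Γ σ Ω)
    (hσ : ∀ x ∈ Γ, σ'.lookup x = σ.lookup x) : Env t Γ σ' Ω := by
  obtain ⟨f, hΩ, hf⟩ := h
  refine ⟨f, hΩ, fun x C hx => ?_⟩
  rw [hσ x (Finmap.mem_of_lookup_eq_some hx)]
  exact hf x C hx

theorem Env.erase {Γ : Ctx τ V} {σ : Subst L V} {Ω : Procs τ L V} {x : V} (h : Env t Γ σ Ω)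
    (hx : x ∉ Γ) : Env t Γ (σ.erase x) Ω :=
  h.congr fun y hy => Finmap.lookup_erase_ne (by rintro rfl; exact hx hy)

theorem Env.union {Γ₁ Γ₂ : Ctx τ V} {σ : Subst L V} {Ω : Procs τ L V}
    (h : Env t (Γ₁ ∪ Γ₂) σ Ω) (hd : Γ₁.Disjoint Γ₂) :
    ∃ Ω₁ Ω₂, Ω = Ω₁ + Ω₂ ∧ Env t Γ₁ σ Ω₁ ∧ Env t Γ₂ σ Ω₂ := by
  obtain ⟨f, rfl, hf⟩ := h
  refine ⟨∑ x ∈ Γ₁.keys, f x, ∑ x ∈ Γ₂.keys, f x, ?_, ⟨f, rfl, fun x C hx => hf x C ?_⟩,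
    ⟨f, rfl, fun x C hx => hf x C ?_⟩⟩
  · rw [Finmap.keys_union, Finset.sum_union]
    exact Finset.disjoint_left.mpr fun x h₁ h₂ =>
      hd x (Finmap.mem_keys.mp h₁) (Finmap.mem_keys.mp h₂)
  · rw [Finmap.lookup_union_left (Finmap.mem_of_lookup_eq_some hx), hx]
  · rw [Finmap.lookup_union_right fun h => hd x h (Finmap.mem_of_lookup_eq_some hx), hx]

theorem Env.of_insert {Γ : Ctx τ V} {σ : Subst L V} {Ω : Procs τ L V} {x : V} {C : Ty τ}
    (h : Env t (Γ.insert x C) σ Ω) (hx : x ∉ Γ) :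
    ∃ b Ω₀ Ω₁, σ.lookup x = some b ∧ Ω = Ω₀ + Ω₁ ∧ Env t Γ σ Ω₀ ∧ Provider t b C Ω₁ := by
  obtain ⟨f, rfl, hf⟩ := h
  obtain ⟨b, hb, hp⟩ := hf x C (Finmap.lookup_insert Γ)
  refine ⟨b, ∑ y ∈ Γ.keys, f y, f x, hb, ?_, ⟨f, rfl, fun y D hy => hf y D ?_⟩, hp⟩
  · rw [keys_insert, Finset.sum_insert (by simpa [Finmap.mem_keys]), add_comm]
  · rw [Finmap.lookup_insert_of_ne _ (by rintro rfl; exact hx (Finmap.mem_of_lookup_eq_some hy)),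
      hy]

theorem Env.insert {Γ : Ctx τ V} {σ : Subst L V} {Ω₀ Ω₁ : Procs τ L V} {x : V} {C : Ty τ} {b : L}
    (h : Env t Γ σ Ω₀) (hx : x ∉ Γ) (hb : σ.lookup x = some b) (hp : Provider t b C Ω₁) :
    Env t (Γ.insert x C) σ (Ω₀ + Ω₁) := by
  obtain ⟨f, rfl, hf⟩ := h
  have hne : ∀ y ∈ Γ, y ≠ x := by rintro y hy rfl; exact hx hy
  refine ⟨Function.update f x Ω₁, ?_, fun y D hy => ?_⟩
  · rw [keys_insert, Finset.sum_insert (by simpa [Finmap.mem_keys]), add_comm,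
      Function.update_self]
    congr 1
    exact Finset.sum_congr rfl fun y hy =>
      (Function.update_of_ne (hne y (Finmap.mem_keys.mp hy)) _ _).symm
  · by_cases hyx : y = x
    · subst hyx
      rw [Finmap.lookup_insert] at hy
      cases hy
      exact ⟨b, hb, by rwa [Function.update_self]⟩
    · rw [Finmap.lookup_insert_of_ne _ hyx] at hy
      rw [Function.update_of_ne hyx]
      exact hf y D hy

/-- The environment of a body whose bound variable has been instantiated by the channel of a new
provider. -/
theorem Env.insert_insert {Γ : Ctx τ V} {σ : Subst L V} {Ω₀ Ω₁ : Procs τ L V} {x : V} {C : Ty τ}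
    {b : L} (h : Env t Γ σ Ω₀) (hx : x ∉ Γ) (hp : Provider t b C Ω₁) :
    Env t (Γ.insert x C) (σ.insert x b) (Ω₀ + Ω₁) := by
  refine Env.insert (h.congr fun y hy => ?_) hx (Finmap.lookup_insert σ) hp
  exact Finmap.lookup_insert_of_ne _ (by rintro rfl; exact hx hy)

/-- Every process of an environment lies in the tree of one of its providers, and that tree may be
exchanged for another provider of the same channel. -/
theorem Env.exists_provider {Γ : Ctx τ V} {σ : Subst L V} {Ω : Procs τ L V} (h : Env t Γ σ Ω)
    {y : L × Tm τ L V} (hy : y ∈ Ω) :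
    ∃ b C Ω₀ Ω₁, Ω = Ω₀ + Ω₁ ∧ y ∈ Ω₁ ∧ Provider t b C Ω₁ ∧
      ∀ Ω₂, Provider t b C Ω₂ → Env t Γ σ (Ω₀ + Ω₂) := by
  obtain ⟨f, rfl, hf⟩ := h
  obtain ⟨x, hx, hy⟩ := Multiset.mem_sum.mp hy
  obtain ⟨C, hC⟩ := Finmap.mem_iff.mp (Finmap.mem_keys.mp hx)
  obtain ⟨b, hb, hp⟩ := hf x C hC
  refine ⟨b, C, ∑ z ∈ Γ.keys.erase x, f z, f x, (Finset.sum_erase_add _ _ hx).symm, hy, hp,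
    fun Ω₂ h₂ => ⟨Function.update f x Ω₂, ?_, fun z D hz => ?_⟩⟩
  · rw [← Finset.sum_erase_add _ _ hx, Function.update_self]
    congr 1
    exact Finset.sum_congr rfl fun z hz =>
      (Function.update_of_ne (Finset.ne_of_mem_erase hz) _ _).symm
  · by_cases hzx : z = x
    · subst hzx
      cases hC.symm.trans hz
      exact ⟨b, hb, by rwa [Function.update_self]⟩
    · rw [Function.update_of_ne hzx]
      exact hf z D hz

/-! ### Canonical forms of waiting providers -/

section

variable [Nonempty L] {Ω : Procs τ L V} {N : Tm τ L V} {p : τ → Prop} {A₁ A₂ : τ → Ty τ}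

theorem WellTyped.one_inv (h : WellTyped t Ω N (.one p)) (hN : N.clock = none) :
    N = .closeR p ∧ Ω = 0 := by
  obtain ⟨T, Γ, σ, M, rfl, hM, -, f, rfl, -⟩ := wellTyped_iff.mp h
  cases hM with
  | oneR => exact ⟨rfl, by simp⟩
  | _ => cases hN

theorem WellTyped.lolli_inv (h : WellTyped t Ω N (.lolli p A₁ A₂)) (hN : N.clock = none) :
    ∃ (Γ : Ctx τ V) (σ : Subst L V) (x : V) (M : τ → Tm τ L V),
      N = .lolliR p x (fun s => (M s).subst (σ.erase x)) ∧ x ∉ Γ ∧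
      (∀ s, p s → Typed s (Γ.insert x (A₁ s)) (M s) (A₂ s)) ∧ Env t Γ σ Ω := by
  obtain ⟨T, Γ, σ, M, rfl, hM, -, hE⟩ := wellTyped_iff.mp h
  cases hM with
  | lolliR _ _ x _ _ _ M hx hM => exact ⟨Γ, σ, x, M, rfl, hx, hM, hE⟩
  | _ => cases hN

theorem WellTyped.tensor_inv (h : WellTyped t Ω N (.tensor p A₁ A₂)) (hN : N.clock = none) :
    ∃ (Γ₁ Γ₂ : Ctx τ V) (σ : Subst L V) (M₁ M₂ : τ → Tm τ L V) (Ω₁ Ω₂ : Procs τ L V),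
      N = .tensorR p (fun s => (M₁ s).subst σ) (fun s => (M₂ s).subst σ) ∧
      (∀ s, p s → Typed s Γ₁ (M₁ s) (A₁ s)) ∧ (∀ s, p s → Typed s Γ₂ (M₂ s) (A₂ s)) ∧
      Ω = Ω₁ + Ω₂ ∧ Env t Γ₁ σ Ω₁ ∧ Env t Γ₂ σ Ω₂ := by
  obtain ⟨T, Γ, σ, M, rfl, hM, -, hE⟩ := wellTyped_iff.mp h
  cases hM with
  | tensorR _ Γ₁ Γ₂ _ _ _ M₁ M₂ hd h₁ h₂ =>
    obtain ⟨Ω₁, Ω₂, hΩ, hE₁, hE₂⟩ := hE.union hd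
    exact ⟨Γ₁, Γ₂, σ, M₁, M₂, Ω₁, Ω₂, rfl, h₁, h₂, hΩ, hE₁, hE₂⟩
  | _ => cases hN

theorem WellTyped.amp_inv (h : WellTyped t Ω N (.amp p A₁ A₂)) (hN : N.clock = none) :
    ∃ (Γ : Ctx τ V) (σ : Subst L V) (M₁ M₂ : τ → Tm τ L V),
      N = .ampR p (fun s => (M₁ s).subst σ) (fun s => (M₂ s).subst σ) ∧
      (∀ s, p s → Typed s Γ (M₁ s) (A₁ s)) ∧ (∀ s, p s → Typed s Γ (M₂ s) (A₂ s)) ∧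
      Env t Γ σ Ω := by
  obtain ⟨T, Γ, σ, M, rfl, hM, -, hE⟩ := wellTyped_iff.mp h
  cases hM with
  | ampR _ _ _ _ _ M₁ M₂ h₁ h₂ => exact ⟨Γ, σ, M₁, M₂, rfl, h₁, h₂, hE⟩
  | _ => cases hN

theorem WellTyped.plus_inv (h : WellTyped t Ω N (.plus p A₁ A₂)) (hN : N.clock = none) :
    ∃ (Γ : Ctx τ V) (σ : Subst L V) (e : Sel) (M : τ → Tm τ L V),
      N = .plusR p e (fun s => (M s).subst σ) ∧
      (∀ s, p s → Typed s Γ (M s) (e.pick (A₁ s) (A₂ s))) ∧ Env t Γ σ Ω := by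
  obtain ⟨T, Γ, σ, M, rfl, hM, -, hE⟩ := wellTyped_iff.mp h
  cases hM with
  | plusR _ _ _ _ _ e M hM => exact ⟨Γ, σ, e, M, rfl, hM, hE⟩
  | _ => cases hN

end

end

/-! ### Rounds of silent steps -/

/-- Finitely many silent steps at a fixed time. -/
def Silent (t : τ) : Cfg τ L → Cfg τ L → Prop :=
  Relation.ReflTransGen fun Ω Ω' => Step Ω .eps t Ω'

theorem Silent.frame {t : τ} {Ω Ω' : Cfg τ L} (h : Silent t Ω Ω') (Ω₀ : Cfg τ L) :
    Silent t (Ω₀ + Ω) (Ω₀ + Ω') :=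
  Relation.ReflTransGen.lift (fun X => Ω₀ + X) (fun X Y hXY => by
    have := Step.frame X Y Ω₀ .eps t hXY
    rwa [add_comm X, add_comm Y] at this) _ _ h

/-- The configuration formed by a multiset of processes. -/
def embed [DecidableEq V] (X : Procs τ L V) : Cfg τ L :=
  X.map fun y => Atomic.proc y.1 ⟨tmLang τ L V, y.2⟩

theorem embed_add [DecidableEq V] (X Y : Procs τ L V) : embed (X + Y) = embed X + embed Y :=
  Multiset.map_add _ X Y

/-- The multiset of the ranks of processes. -/
noncomputable def ranks (X : Procs τ L V) : Multiset Ordinal.{u} :=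
  X.map fun y => y.2.rank

theorem ranks_add (X Y : Procs τ L V) : ranks (X + Y) = ranks X + ranks Y :=
  Multiset.map_add _ X Y

/-- A round of evaluation at time `t`: whatever the name of the root channel is, silent steps lead
from `(Ω, P)` to `(Ω', P')`, and the ranks decrease in the Dershowitz–Manna order. -/
structure Advance [DecidableEq V] (t : τ) (Ω : Procs τ L V) (P : Tm τ L V) (Ω' : Procs τ L V)
    (P' : Tm τ L V) : Prop where
  silent : ∀ a, Silent t (embed (Ω + {(a, P)})) (embed (Ω' + {(a, P')}))
  decreases : Multiset.IsDershowitzMannaLT (ranks Ω' + {P'.rank}) (ranks Ω + {P.rank})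

theorem Advance.frame [DecidableEq V] {t : τ} {Ω Ω' : Procs τ L V} {N N' : Tm τ L V}
    (h : Advance t Ω N Ω' N') (Ω₀ : Procs τ L V) (b : L) (P : Tm τ L V) :
    Advance t (Ω₀ + (Ω + {(b, N)})) P (Ω₀ + (Ω' + {(b, N')})) P where
  silent a := by
    have := (h.silent b).frame (embed (Ω₀ + {(a, P)}))
    rwa [← embed_add, ← embed_add, add_right_comm, add_right_comm Ω₀ _ (Ω' + _)] at this
  decreases := by
    obtain ⟨X, Y, Z, hZ, h₁, h₂, hYZ⟩ := h.decreases
    refine ⟨ranks Ω₀ + {P.rank} + X, Y, Z, hZ, ?_, ?_, hYZ⟩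
    · rw [add_assoc _ X, ← h₁, ranks_add, ranks_add, add_right_comm]
      rfl
    · rw [add_assoc _ X, ← h₂, ranks_add, ranks_add, add_right_comm]
      rfl

/-- A round in which the root, possibly together with further processes `X`, is replaced by
processes of smaller rank. -/
theorem Advance.of_silent [DecidableEq V] {t : τ} {Ω X Y : Procs τ L V} {P P' : Tm τ L V}
    (h : ∀ a, Silent t (embed (X + {(a, P)})) (embed (Y + {(a, P')})))
    (hY : ∀ r ∈ ranks Y + {P'.rank}, ∃ s ∈ ranks X + {P.rank}, r < s) :
    Advance t (Ω + X) P (Ω + Y) P' where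
  silent a := by
    have := (h a).frame (embed Ω)
    rwa [← embed_add, ← embed_add, ← add_assoc, ← add_assoc] at this
  decreases := by
    refine ⟨ranks Ω, ranks Y + {P'.rank}, ranks X + {P.rank}, by simp, ?_, ?_, hY⟩
    · rw [ranks_add, add_assoc]
    · rw [ranks_add, add_assoc]

theorem step_of_tm [DecidableEq V] {t : τ} {M : Tm τ L V} {a : L} {α : Action L}
    {X : Procs τ L V} (h : Tm.Step M a α t (X.map fun y => Atomic.proc y.1 y.2)) :
    Step (embed {(a, M)}) α t (embed X) := by
  have key : (X.map fun y => Atomic.proc y.1 y.2).map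
      (Atomic.map fun x => (⟨tmLang τ L V, x⟩ : NObj τ L)) = embed X := Multiset.map_map _ _ X
  exact key ▸ Step.obj (tmLang τ L V) M a α t _ h

/-- A communication in which the root sends. -/
theorem silent_of_send [DecidableEq V] {t : τ} {P N : Tm τ L V} {a b : L} {c : Payload L}
    {X Y Z : Procs τ L V}
    (hP : Tm.Step P a (.comm b .send c) t (X.map fun y => Atomic.proc y.1 y.2))
    (hN : Tm.Step N b (.comm b .recv c) t (Y.map fun y => Atomic.proc y.1 y.2))
    (hZ : X + Y = Z) : Silent t (embed ({(b, N)} + {(a, P)})) (embed Z) := by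
  rw [← hZ, add_comm, embed_add, embed_add]
  exact .single (.comm _ _ _ _ b c t (step_of_tm hP) (step_of_tm hN))

/-- A communication in which the root receives. -/
theorem silent_of_recv [DecidableEq V] {t : τ} {P N : Tm τ L V} {a b : L} {c : Payload L}
    {X Y Z : Procs τ L V}
    (hP : Tm.Step P a (.comm b .recv c) t (X.map fun y => Atomic.proc y.1 y.2))
    (hN : Tm.Step N b (.comm b .send c) t (Y.map fun y => Atomic.proc y.1 y.2))
    (hZ : Y + X = Z) : Silent t (embed ({(b, N)} + {(a, P)})) (embed Z) := by
  rw [← hZ, embed_add, embed_add]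
  exact .single (.comm _ _ _ _ b c t (step_of_tm hN) (step_of_tm hP))

/-- A forwarding root is replaced by the process that it forwards to.  The intermediate
configuration with a forwarding object is left at once, so `Procs` need not include such objects. -/
theorem Advance.fwd [DecidableEq V] (t : τ) (Ω : Procs τ L V) (b : L) (N : Tm τ L V) :
    Advance t (Ω + {(b, N)}) (.fwd t (.chan b)) Ω N where
  silent a := by
    rw [add_assoc, embed_add, embed_add Ω]
    refine Silent.frame (Relation.ReflTransGen.head
      (b := {Atomic.proc b ⟨tmLang τ L V, N⟩, Atomic.fwd a b}) ?_ (.single ?_)) _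
    · have h : Step (embed {(a, (.fwd t (.chan b) : Tm τ L V))}) .eps t {Atomic.fwd a b} :=
        Step.obj (tmLang τ L V) (.fwd t (.chan b)) a .eps t _ (Tm.Step.fwd t a b)
      have := Step.frame _ _ (embed {(b, N)}) _ _ h
      rwa [← embed_add, add_comm, add_comm {Atomic.fwd a b}] at this
    · exact Step.fwd b a _ t
  decreases := by
    refine ⟨ranks Ω + {N.rank}, 0, {(Tm.fwd t (.chan b) : Tm τ L V).rank}, by simp, by simp, ?_,
      by simp⟩
    rw [ranks_add]
    rfl

/-! ### Progress -/

section

variable [LinearOrder τ] [DecidableEq V] [Nonempty L] {t : τ}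

/-- If the root is due at time `t` and nothing else is, then it can act: a provider with which it
communicates is waiting for it. -/
theorem WellTyped.advance_root {Ω : Procs τ L V} {P : Tm τ L V} {A : Ty τ}
    (h : WellTyped t Ω P A) (hP : P.clock = some t) (hΩ : ∀ y ∈ Ω, y.2.clock ≠ some t) :
    ∃ Ω' P' B, WellTyped t Ω' P' B ∧ RetypeCut t B A ∧ Advance t Ω P Ω' P' := by
  obtain ⟨T, Γ, σ, M, rfl, hM, -, hE⟩ := wellTyped_iff.mp h
  rw [Tm.clock_subst] at hP
  -- Which channel is allocated does not matter; see `WellTyped`.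
  have c : L := Classical.arbitrary L
  cases hM with
  | oneR | lolliR | tensorR | ampR | plusR => cases hP
  | cut _ Γ₁ Γ₂ x A₀ A' _ M₁ M₂ hd hx h₁ h₂ hA =>
    cases hP
    obtain ⟨Ω₁, Ω₂, rfl, hE₁, hE₂⟩ := hE.union hd
    have hp : Provider t c A' (Ω₁ + {(c, M₁.subst σ)}) := ⟨_, _, _, rfl, .of_typed h₁ hE₁, hA⟩
    refine ⟨_, _, A, .of_typed h₂ (hE₂.insert_insert hx hp), .refl _ _, ?_⟩
    -- Here and below, the processes that the step consumes and produces are moved to the end.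
    have key : Advance t (Ω₁ + Ω₂ + 0) ((Tm.letIn t x A' M₁ M₂).subst σ)
        (Ω₁ + Ω₂ + {(c, M₁.subst σ)}) (M₂.subst (σ.insert x c)) := by
      refine .of_silent (fun a => .single ?_) ?_
      · rw [zero_add]
        refine step_of_tm ?_
        rw [← Tm.subst_erase_singleton]
        exact Tm.Step.letIn t x A' _ _ a c
      · simp [ranks, Tm.subst, Tm.rank, Order.lt_add_one_iff]
    convert key using 1
    · simp
    · abel
  | fwd _ x A₀ _ hA =>
    cases hP
    obtain ⟨f, rfl, hf⟩ := hE
    obtain ⟨b, hb, Ω, N, B, h₁, hN, hB⟩ := hf x A₀ Finmap.lookup_singleton_eq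
    refine ⟨Ω, N, B, hN, hB.trans hA.toCut, ?_⟩
    simpa [Tm.subst, Sym.subst, hb, h₁] using Advance.fwd t Ω b N
  | oneL _ T' Γ x p M C hx hM hT hp =>
    cases hP
    obtain ⟨b, Ω₀, _, hb, rfl, hE₀, Ω₁, N, B, rfl, hN, hB⟩ := hE.of_insert hx
    have hN' := hN.clock_eq_none hB hp (hΩ (b, N) (by simp))
    cases hB with | one _ q _ hq =>
    obtain ⟨rfl, rfl⟩ := hN.one_inv hN'
    refine ⟨Ω₀, _, _, .of_typed hM (hE₀.erase hx), .refl _ _, ?_⟩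
    have key : Advance t (Ω₀ + {(b, .closeR q)}) ((Tm.closeL t (.var x) M).subst σ) (Ω₀ + 0)
        (M.subst (σ.erase x)) := by
      refine .of_silent (fun a => ?_) ?_
      · simp only [Tm.subst, Sym.subst, hb, Sym.removeFrom]
        exact silent_of_recv (X := {(a, _)}) (Y := 0) (Tm.Step.closeL t a b _)
          (Tm.Step.closeR q t b (hq t le_rfl hp)) rfl
      · simp [ranks, Tm.subst, Tm.rank, Order.lt_add_one_iff]
    simpa using key
  | lolliL _ T' Γ₁ Γ₂ x p A₁ A₂ C M₁ M₂ hd hx₁ hx₂ h₁ h₂ hT hp =>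
    cases hP
    obtain ⟨b, Ω₀, _, hb, rfl, hE₀, Ω', N, B, rfl, hN, hB⟩ :=
      hE.of_insert (by simp [hx₁, hx₂])
    obtain ⟨Ω₁, Ω₂, rfl, hE₁, hE₂⟩ := hE₀.union hd
    have hN' := hN.clock_eq_none hB hp (hΩ (b, N) (by simp))
    cases hB with | lolli _ q _ B₁ B₂ _ _ hq hB₁ hB₂ =>
    obtain ⟨Γ', σ', y, M', rfl, hy, hM', hE'⟩ := hN.lolli_inv hN'
    have hqt := hq t le_rfl hp
    have hc : Provider t c (B₁ t) (Ω₁ + {(c, M₁.subst σ)}) :=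
      ⟨_, _, _, rfl, .of_typed h₁ hE₁, hB₁ t le_rfl hp⟩
    have hb' : Provider t b (A₂ t) (Ω' + (Ω₁ + {(c, M₁.subst σ)}) +
        {(b, (M' t).subst (σ'.insert y c))}) :=
      ⟨_, _, _, rfl, .of_typed (hM' t hqt) (hE'.insert_insert hy hc), hB₂ t le_rfl hp⟩
    refine ⟨_, _, _, .of_typed h₂ (hE₂.insert hx₂ hb hb'), .refl _ _, ?_⟩
    have key : Advance t (Ω₁ + Ω₂ + Ω' + {(b, .lolliR q y fun s => (M' s).subst (σ'.erase y))})
        ((Tm.lolliL t (.var x) M₁ M₂).subst σ)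
        (Ω₁ + Ω₂ + Ω' + ({(c, M₁.subst σ)} + {(b, (M' t).subst (σ'.insert y c))}))
        (M₂.subst σ) := by
      refine .of_silent (fun a => ?_) ?_
      · simp only [Tm.subst, Sym.subst, hb]
        rw [← Tm.subst_erase_singleton]
        exact silent_of_send (X := {(c, _), (a, _)}) (Y := {(b, _)})
          (Tm.Step.lolliL t a b c _ _) (Tm.Step.lolliR q t b c y _ hqt)
          (by simp only [Multiset.insert_eq_cons, ← Multiset.singleton_add]; abel)
      · have := lt_iSup_add_one (fun s => (M' s).rank) t
        simp [ranks, Tm.subst, Tm.rank, Order.lt_add_one_iff] at this ⊢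
        exact Or.inl this
    convert key using 1 <;> abel
  | tensorL _ T' Γ x y p A₁ A₂ C M hx hy hxy hM hT hp =>
    cases hP
    obtain ⟨b, Ω₀, _, hb, rfl, hE₀, Ω', N, B, rfl, hN, hB⟩ := hE.of_insert hx
    have hN' := hN.clock_eq_none hB hp (hΩ (b, N) (by simp))
    cases hB with | tensor _ q _ B₁ B₂ _ _ hq hB₁ hB₂ =>
    obtain ⟨Γ₁, Γ₂, σ', M₁, M₂, Ω₁, Ω₂, rfl, h₁, h₂, rfl, hE₁, hE₂⟩ := hN.tensor_inv hN'
    have hqt := hq t le_rfl hp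
    have hc : Provider t c (A₁ t) (Ω₁ + {(c, (M₁ t).subst σ')}) :=
      ⟨_, _, _, rfl, .of_typed (h₁ t hqt) hE₁, hB₁ t le_rfl hp⟩
    have hb' : Provider t b (A₂ t) (Ω₂ + {(b, (M₂ t).subst σ')}) :=
      ⟨_, _, _, rfl, .of_typed (h₂ t hqt) hE₂, hB₂ t le_rfl hp⟩
    refine ⟨_, _, _, .of_typed hM ((hE₀.insert hx hb hb').insert_insert
      (by simp [hy, Ne.symm hxy]) hc), .refl _ _, ?_⟩
    have key : Advance t
        (Ω₀ + Ω₁ + Ω₂ + {(b, .tensorR q (fun s => (M₁ s).subst σ') fun s => (M₂ s).subst σ')})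
        ((Tm.tensorL t (.var x) y M).subst σ)
        (Ω₀ + Ω₁ + Ω₂ + ({(b, (M₂ t).subst σ')} + {(c, (M₁ t).subst σ')}))
        (M.subst (σ.insert y c)) := by
      refine .of_silent (fun a => ?_) ?_
      · simp only [Tm.subst, Sym.subst, hb]
        rw [← Tm.subst_erase_singleton]
        exact silent_of_recv (X := {(a, _)}) (Y := {(b, _), (c, _)})
          (Tm.Step.tensorL t a b c y _) (Tm.Step.tensorR q t b c _ _ hqt)
          (by simp only [Multiset.insert_eq_cons, ← Multiset.singleton_add])
      · have := lt_iSup_add_one (fun s => max (M₁ s).rank (M₂ s).rank) t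
        rw [max_lt_iff] at this
        simp [ranks, Tm.subst, Tm.rank, Order.lt_add_one_iff] at this ⊢
        exact ⟨Or.inl this.2, Or.inl this.1⟩
    convert key using 1 <;> abel
  | ampL _ T' Γ x p A₁ A₂ C e M hx hM hT hp =>
    cases hP
    obtain ⟨b, Ω₀, _, hb, rfl, hE₀, Ω', N, B, rfl, hN, hB⟩ := hE.of_insert hx
    have hN' := hN.clock_eq_none hB hp (hΩ (b, N) (by simp))
    cases hB with | amp _ q _ B₁ B₂ _ _ hq hB₁ hB₂ =>
    obtain ⟨Γ', σ', M₁, M₂, rfl, h₁, h₂, hE'⟩ := hN.amp_inv hN'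
    have hqt := hq t le_rfl hp
    have hb' : Provider t b (e.pick (A₁ t) (A₂ t))
        (Ω' + {(b, e.pick ((M₁ t).subst σ') ((M₂ t).subst σ'))}) := by
      cases e
      · exact ⟨_, _, _, rfl, .of_typed (h₁ t hqt) hE', hB₁ t le_rfl hp⟩
      · exact ⟨_, _, _, rfl, .of_typed (h₂ t hqt) hE', hB₂ t le_rfl hp⟩
    refine ⟨_, _, _, .of_typed hM (hE₀.insert hx hb hb'), .refl _ _, ?_⟩
    rw [← add_assoc, ← add_assoc]
    refine .of_silent (fun a => ?_) ?_
    · simp only [Tm.subst, Sym.subst, hb]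
      exact silent_of_send (X := {(a, _)}) (Y := {(b, _)})
        (Tm.Step.ampL t a b e _) (Tm.Step.ampR q t b e _ _ hqt) (add_comm _ _)
    · have := lt_iSup_add_one (fun s => max (M₁ s).rank (M₂ s).rank) t
      rw [max_lt_iff] at this
      cases e <;> simp [ranks, Tm.subst, Tm.rank, Order.lt_add_one_iff, Sel.pick] at this ⊢
      · exact Or.inl this.1
      · exact Or.inl this.2
  | plusL _ T' Γ x p A₁ A₂ C M₁ M₂ hx h₁ h₂ hT hp =>
    cases hP
    obtain ⟨b, Ω₀, _, hb, rfl, hE₀, Ω', N, B, rfl, hN, hB⟩ := hE.of_insert hx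
    have hN' := hN.clock_eq_none hB hp (hΩ (b, N) (by simp))
    cases hB with | plus _ q _ B₁ B₂ _ _ hq hB₁ hB₂ =>
    obtain ⟨Γ', σ', e, M', rfl, hM', hE'⟩ := hN.plus_inv hN'
    have hqt := hq t le_rfl hp
    have hb' : Provider t b (e.pick (A₁ t) (A₂ t)) (Ω' + {(b, (M' t).subst σ')}) := by
      refine ⟨_, _, _, rfl, .of_typed (hM' t hqt) hE', ?_⟩
      cases e
      · exact hB₁ t le_rfl hp
      · exact hB₂ t le_rfl hp
    have hM : Typed t (Γ.insert x (e.pick (A₁ t) (A₂ t))) (e.pick M₁ M₂) A := by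
      cases e
      · exact h₁
      · exact h₂
    refine ⟨_, _, _, .of_typed hM (hE₀.insert hx hb hb'), .refl _ _, ?_⟩
    rw [← add_assoc, ← add_assoc]
    refine .of_silent (fun a => ?_) ?_
    · have he : (e.pick M₁ M₂).subst σ = e.pick (M₁.subst σ) (M₂.subst σ) := by cases e <;> rfl
      rw [he]
      simp only [Tm.subst, Sym.subst, hb]
      exact silent_of_recv (X := {(a, _)}) (Y := {(b, _)})
        (Tm.Step.plusL t a b e _ _) (Tm.Step.plusR q t b e _ hqt) rfl
    · have := lt_iSup_add_one (fun s => (M' s).rank) t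
      cases e <;> simp [ranks, Tm.subst, Tm.rank, Order.lt_add_one_iff, Sel.pick] at this ⊢
      · exact Or.inl this
      · exact Or.inl this

/-- If some process of the tree is due at time `t`, then the tree can act: the lowest due process
is the root of a subtree in which nothing else is due. -/
theorem WellTyped.advance {Ω : Procs τ L V} {P : Tm τ L V} {A : Ty τ} (h : WellTyped t Ω P A)
    (hdue : P.clock = some t ∨ ∃ y ∈ Ω, y.2.clock = some t) :
    ∃ Ω' P' B, WellTyped t Ω' P' B ∧ RetypeCut t B A ∧ Advance t Ω P Ω' P' := by
  induction hn : Multiset.card Ω using Nat.strong_induction_on generalizing Ω P A with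
  | _ n ih =>
    by_cases hΩ : ∃ y ∈ Ω, y.2.clock = some t
    · obtain ⟨y, hy, hyt⟩ := hΩ
      obtain ⟨T, Γ, σ, M, rfl, hM, hc, hE⟩ := wellTyped_iff.mp h
      obtain ⟨b, C, Ω₀, _, rfl, hy, ⟨Ω₁, N, B, rfl, hN, hB⟩, hE'⟩ := hE.exists_provider hy
      have hlt : Multiset.card Ω₁ < n := by simp [← hn]; omega
      have hdue' : N.clock = some t ∨ ∃ y ∈ Ω₁, y.2.clock = some t := by
        rcases Multiset.mem_add.mp hy with hy | hy
        · exact Or.inr ⟨y, hy, hyt⟩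
        · rw [Multiset.mem_singleton] at hy
          subst hy
          exact Or.inl hyt
      obtain ⟨Ω₂, N', B', hN', hB', hadv⟩ := ih _ hlt hN hdue' rfl
      exact ⟨_, _, A, wellTyped_iff.mpr ⟨T, Γ, σ, M, rfl, hM, hc,
        hE' _ ⟨Ω₂, N', B', rfl, hN', hB'.trans hB⟩⟩, .refl _ _, hadv.frame Ω₀ b _⟩
    · push Not at hΩ
      refine h.advance_root (hdue.resolve_right ?_) hΩ
      rintro ⟨y, hy, hyt⟩
      exact hΩ y hy hyt

end

/-! ### Trajectories -/

section

variable [LinearOrder τ] [DecidableEq V] {p : τ → Prop} {t T : τ}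

theorem Traj.map_extend {X Y : Type*} (f : X → Y) (x : X) (T₀ : τ) {T₁ : τ} {T₂ : WithTop τ}
    (s : Traj X T₁ T₂) : (s.extend x T₀).map f = (s.map f).extend (f x) T₀ := by
  funext t h h'
  by_cases ht : t < T₁ <;> simp [Traj.map, Traj.extend, Traj.concat, Traj.const, ht]

theorem Silent.exists_realizes {T' : WithTop τ} {T'' : τ} {Ω Ω' Ω'' : Cfg τ L}
    (h : Silent t Ω Ω') {s : Traj (Cfg τ L) t T'} (σ : MultiStep Ω' t Ω'' T'')
    (hσ : Realizes s σ) : ∃ σ' : MultiStep Ω t Ω'' T'', Realizes s σ' := by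
  induction h using Relation.ReflTransGen.head_induction_on with
  | refl => exact ⟨σ, hσ⟩
  | head hs _ ih =>
    obtain ⟨σ', hσ'⟩ := ih
    exact ⟨.stepC hs σ', .stepC hs hσ'⟩

/-- There is a computable trajectory from `Ω` on `[t, ∞)` whose value at the time `T` satisfies
`Q`. -/
def Reaches (T : τ) (Q : NCfg τ L → Prop) (t : τ) (Ω : NCfg τ L) : Prop :=
  ∃ (h : t ≤ T) (w : CompTraj L t (⊤ : WithTop τ)), w.start = Ω ∧
    Q (w.ntraj T h (WithTop.coe_lt_top T))

theorem Reaches.refl {Q : NCfg τ L → Prop} {Ω : NCfg τ L} (hΩ : Q Ω) : Reaches T Q T Ω :=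
  ⟨le_rfl, ⟨Ω, Ω, .const Ω T ⊤, fun _ => T, fun _ => .refl _ T,
    fun _ => .refl _ T (WithTop.coe_lt_top T)⟩, rfl, hΩ⟩

theorem Reaches.of_silent {Q : NCfg τ L → Prop} {Ω Ω' : NCfg τ L}
    (hs : ∀ a, Silent t (Ω.inst a) (Ω'.inst a)) (h : Reaches T Q t Ω') : Reaches T Q t Ω := by
  obtain ⟨hT, ⟨start, finish, s, stepTo, steps, hw⟩, rfl, hQ⟩ := h
  choose σ hσ using fun a => (hs a).exists_realizes (steps a) (hw a)
  exact ⟨hT, ⟨Ω, finish, s, stepTo, σ, hσ⟩, rfl, hQ⟩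

theorem Reaches.of_le {t' : τ} {Q : NCfg τ L → Prop} {Ω : NCfg τ L} (ht : t ≤ t')
    (h : Reaches T Q t' Ω) : Reaches T Q t Ω := by
  obtain ⟨hT, ⟨start, finish, s, stepTo, steps, hw⟩, rfl, hQ⟩ := h
  refine ⟨ht.trans hT, ⟨start, finish, s.extend start t, stepTo, fun a => .stepT ht (steps a),
    fun a => ?_⟩, rfl, ?_⟩
  · rw [Traj.map_extend]
    exact .stepT ht (hw a)
  · simpa [Traj.extend, Traj.concat, not_lt.mpr hT] using hQ

/-- Adequacy for process trees: jump to the first time at which a process is due, let the tree act,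
and repeat. -/
theorem WellTyped.reaches [Nonempty L] {Ω : Procs τ L V} {P : Tm τ L V} {A : Ty τ} (a : L)
    (h : WellTyped t Ω P A) (hA : RetypeCut t A (.one p)) (ht : t ≤ T) (hp : p T) :
    Reaches T (fun Ω => Step (Ω.inst a) (.comm a .send .close) T ∅) t
      (embed Ω, ⟨tmLang τ L V, P⟩) := by
  induction hn : ranks Ω + {P.rank} using
    (Multiset.wellFounded_isDershowitzMannaLT (α := Ordinal.{u})).induction
    generalizing Ω P A t with
  | _ n ih =>
    subst hn
    let clocks : Multiset (Option τ) := P.clock ::ₘ Ω.map fun y => y.2.clock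
    have hfin : {c | c ≤ T ∧ some c ∈ clocks}.Finite :=
      ((Multiset.finite_toSet clocks).preimage (Option.some_injective τ).injOn).subset
        fun c hc => hc.2
    have hclocks {c : τ} : some c ∈ clocks ↔ P.clock = some c ∨ ∃ y ∈ Ω, y.2.clock = some c := by
      simp [clocks, eq_comm]
    rcases Set.eq_empty_or_nonempty {c | c ≤ T ∧ some c ∈ clocks} with hempty | hne
    · have hdue {c : τ} (hc : some c ∈ clocks) : T ≤ c := by
        by_contra hcT
        exact Set.eq_empty_iff_forall_notMem.mp hempty c ⟨(not_le.mp hcT).le, hc⟩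
      -- The root is demanded at `T`, so it would be due by then if it were not a provider term.
      have hP : P.clock = none := by
        cases hc : P.clock with
        | none => rfl
        | some c =>
          exact absurd ⟨h.clock_le hc (hA.pred ht hp), hclocks.mpr (.inl hc)⟩
            (Set.eq_empty_iff_forall_notMem.mp hempty c)
      cases hA with | one _ q _ hq =>
      obtain ⟨rfl, rfl⟩ := h.one_inv hP
      refine .of_le ht (.refl ?_)
      have := step_of_tm (X := 0) (Tm.Step.closeR q T a (hq T ht hp) : Tm.Step (V := V) _ _ _ _ _)
      simpa [NCfg.inst, embed] using this
    · obtain ⟨c, ⟨hcT, hc⟩, hmin⟩ := Set.exists_min_image _ id hfin hne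
      have hdue {d : τ} (hd : some d ∈ clocks) : c ≤ d := by
        by_cases hdT : d ≤ T
        · exact hmin d ⟨hdT, hd⟩
        · exact hcT.trans (not_le.mp hdT).le
      have htc : t ≤ c := by
        rcases hclocks.mp hc with hc | ⟨y, hy, hc⟩
        · exact h.le_clock hc
        · exact h.le_clock_of_mem hy hc
      have h' := h.mono htc (fun d hd => hdue (hclocks.mpr (.inl hd)))
        (fun y hy d hd => hdue (hclocks.mpr (.inr ⟨y, hy, hd⟩)))
      obtain ⟨Ω', P', B, hB, hBA, hadv⟩ := h'.advance (hclocks.mp hc)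
      have hr := ih _ hadv.decreases hB (hBA.trans (hA.mono htc)) hcT rfl
      refine .of_le htc (.of_silent (fun b => ?_) hr)
      have := hadv.silent b
      rwa [embed_add, embed_add] at this

end

end TimedSession

theorem mainTheorem2 {τ : Type*} [LinearOrder τ] {L : Type} [Countable L] [Infinite L]
    {V : Type} [DecidableEq V]
    (P : TimedSession.Tm τ L V) (p : τ → Prop) (a : L) (T T' : τ) (hT : T ≤ T')
    (hP : TimedSession.Typed T ∅ P (TimedSession.Ty.one p)) (hp : p T') :
    ∃ w : TimedSession.CompTraj L T (⊤ : WithTop τ),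
      w.start = (∅, ⟨TimedSession.tmLang τ L V, P⟩) ∧
      TimedSession.Step ((w.ntraj T' hT (WithTop.coe_lt_top T')).inst a)
        (TimedSession.Action.comm a TimedSession.Dir.send TimedSession.Payload.close) T' ∅ := by
  have h := TimedSession.WellTyped.of_typed hP (TimedSession.Env.empty ∅)
  rw [TimedSession.Tm.subst_empty] at h
  obtain ⟨_, w, hw, hstep⟩ := h.reaches a (.refl _ _) hT hp
  exact ⟨w, hw, hstep⟩
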